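/- Let $n\ge 0$ and let $\mathcal X=\{0,1\}^n$ be the feasible set of the unconstrained combinatorial problem (UP) $\min\{c^Tx : x\in\mathcal X\}$; write $\mathrm{opt}(c)=\min_{y\in\mathcal X}c^Ty$. For $\hat c,d\in\mathbb R^n$ with $d_i\ge 0$ for all $i$, let $\mathcal U=\prod_{i=1}^n[\hat c_i-d_i,\hat c_i+d_i]$ be the interval (hyperbox) uncertainty set. For $x\in\mathcal X$, the evaluation problem asks for the regret $$Reg(x,\mathcal U)=\max_{c\in\mathcal U}\Bigl(c^Tx-\min_{y\in\mathcal X}c^Ty\Bigr).$$ Then: 1. The minimum and the maximum are attained, and with $c^*_i=\hat c_i+(2x_i-1)d_i$, $$Reg(x,\mathcal U)=\sum_{i=1}^n c^*_i x_i-\sum_{i=1}^n\min(0,c^*_i).$$ 2. The regret can be computed in $O(n)$ arithmetic operations: there are a fixed program of a unit-cost random access machine over $\mathbb R$ (operations: integer constants, $+$, $-$, $\cdot$, comparison, load and store, and increment, copy and comparison of indices) and a constant $C$ such that for all $n$, $\hat c$, all $d\ge 0$ and all $x\in\{0,1\}^n$, the program started on input $(n,\hat c,d,x)$ halts within $C(n+1)$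 steps with output $Reg(x,\mathcal U)$. 3. The evaluation problem of (UP) for interval uncertainty is solvable in polynomial time in the Turing machine model. Let $\hat c_i$ and $d_i\ge 0$ be rational numbers, given as fractions (not necessarily in lowest terms) with numerator and denominator written in binary. Then a Turing machine running in time polynomial in the length of the input $(\hat c,d,x)$ outputs $Reg(x,\mathcal U)$ as a fraction (not necessarily in lowest terms) in binary. Moreover, the decision version, in which an additional rational threshold $K$ is given as a binary fraction and the question is whether $Reg(x,\mathcal U)\ge K$, is in $\mathsf P$. -/

import Mathlib

namespace MinmaxRegret

noncomputable section

/-! ### Minmax regret -/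

/-- The optimal value of the nominal problem with feasible set `X` and objective vector `c`. -/
def opt {n : ℕ} (X : Set (Fin n → ℝ)) (c : Fin n → ℝ) : ℝ :=
  sInf ((fun y => c ⬝ᵥ y) '' X)

/-- The values `cᵀx - opt(c)` for all scenarios `c ∈ U`. -/
def regretValues {n : ℕ} (X U : Set (Fin n → ℝ)) (x : Fin n → ℝ) : Set ℝ :=
  (fun c => c ⬝ᵥ x - opt X c) '' U

/-- The regret of `x` with respect to the uncertainty set `U`. -/
def regret {n : ℕ} (X U : Set (Fin n → ℝ)) (x : Fin n → ℝ) : ℝ :=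
  sSup (regretValues X U x)

/-- The feasible set `{0,1}ⁿ` of the unconstrained combinatorial problem. -/
def binaryCube (n : ℕ) : Set (Fin n → ℝ) :=
  {x | ∀ i, x i = 0 ∨ x i = 1}

/-- Interval (hyperbox) uncertainty with midpoint `chat` and deviations `d`. -/
def hyperbox {n : ℕ} (chat d : Fin n → ℝ) : Set (Fin n → ℝ) :=
  Set.univ.pi fun i => Set.Icc (chat i - d i) (chat i + d i)

/-- The scenario `c*` with `c*_i = chat_i + (2 x_i - 1) d_i`. -/
def worstScenario {n : ℕ} (chat d x : Fin n → ℝ) : Fin n → ℝ :=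
  fun i => chat i + (2 * x i - 1) * d i

/-! ### A random access machine over the reals with unit cost

The machine has real registers `reg`, an array `mem` of real numbers that is accessed only through
the natural numbers in the index registers `idx`, and a program counter. A program is a fixed finite
list of instructions. Every instruction costs one unit of time. -/

inductive RamInstr where
  /-- `reg r := z` -/
  | const (r : ℕ) (z : ℤ)
  /-- `reg r := reg s + reg t` -/
  | add (r s t : ℕ)
  /-- `reg r := reg s - reg t` -/
  | sub (r s t : ℕ)
  /-- `reg r := reg s * reg t` -/
  | mul (r s t : ℕ)
  /-- `reg r := mem (idx i)` -/
  | load (r i : ℕ)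
  /-- `mem (idx i) := reg r` -/
  | store (i r : ℕ)
  /-- `if reg r ≤ reg s then goto p` -/
  | jumpLe (r s p : ℕ)
  /-- `idx i := k` -/
  | idxConst (i k : ℕ)
  /-- `idx i := idx j` -/
  | idxCopy (i j : ℕ)
  /-- `idx i := idx i + 1` -/
  | idxInc (i : ℕ)
  /-- `if idx i < idx j then goto p` -/
  | idxJumpLt (i j p : ℕ)
  /-- `goto p` -/
  | jump (p : ℕ)

structure RamConfig where
  pc : ℕ
  idx : ℕ → ℕ
  reg : ℕ → ℝ
  mem : ℕ → ℝ

open Classical in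
/-- The effect of one instruction on a configuration. -/
def RamInstr.exec (c : RamConfig) : RamInstr → RamConfig
  | .const r z => { c with pc := c.pc + 1, reg := Function.update c.reg r z }
  | .add r s t => { c with pc := c.pc + 1, reg := Function.update c.reg r (c.reg s + c.reg t) }
  | .sub r s t => { c with pc := c.pc + 1, reg := Function.update c.reg r (c.reg s - c.reg t) }
  | .mul r s t => { c with pc := c.pc + 1, reg := Function.update c.reg r (c.reg s * c.reg t) }
  | .load r i => { c with pc := c.pc + 1, reg := Function.update c.reg r (c.mem (c.idx i)) }
  | .store i r => { c with pc := c.pc + 1, mem := Function.update c.mem (c.idx i) (c.reg r) }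
  | .jumpLe r s p => { c with pc := if c.reg r ≤ c.reg s then p else c.pc + 1 }
  | .idxConst i k => { c with pc := c.pc + 1, idx := Function.update c.idx i k }
  | .idxCopy i j => { c with pc := c.pc + 1, idx := Function.update c.idx i (c.idx j) }
  | .idxInc i => { c with pc := c.pc + 1, idx := Function.update c.idx i (c.idx i + 1) }
  | .idxJumpLt i j p => { c with pc := if c.idx i < c.idx j then p else c.pc + 1 }
  | .jump p => { c with pc := p }

/-- One step of the machine. A configuration whose program counter is past the end of the program
is halted and does not change. -/
def ramStep (P : List RamInstr) (c : RamConfig) : RamConfig :=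
  match P[c.pc]? with
  | some I => I.exec c
  | none => c

/-- The start configuration for an evaluation instance: index register `0` holds `n`, and the memory
holds `chat_0, d_0, x_0, chat_1, d_1, x_1, …`; everything else is `0`. -/
def ramInit {n : ℕ} (chat d x : Fin n → ℝ) : RamConfig where
  pc := 0
  idx := fun i => if i = 0 then n else 0
  reg := fun _ => 0
  mem := fun a =>
    if h : a / 3 < n then
      if a % 3 = 0 then chat ⟨a / 3, h⟩ else if a % 3 = 1 then d ⟨a / 3, h⟩ else x ⟨a / 3, h⟩
    else 0

/-- Program `P`, started on `c`, halts after at most `t` steps with `v` in register `0`. -/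
def RamOutputsWithin (P : List RamInstr) (c : RamConfig) (t : ℕ) (v : ℝ) : Prop :=
  P.length ≤ ((ramStep P)^[t] c).pc ∧ ((ramStep P)^[t] c).reg 0 = v

/-! ### Rational instances and their binary encoding -/

/-- A rational number given as a fraction, not necessarily in lowest terms. -/
structure Frac where
  num : ℤ
  den : ℕ
  den_pos : 0 < den

def Frac.val (q : Frac) : ℝ := (q.num : ℝ) / (q.den : ℝ)

/-- A natural number in binary (least significant bit first), followed by a separator. The alphabet
is `Option Bool`: the bits `some false`, `some true` and the separator `none`. -/
def encodeNatSep (m : ℕ) : List (Option Bool) :=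
  m.bits.map some ++ [none]

/-- A sign bit, the absolute value of the numerator and the denominator in binary. -/
def encodeFrac (q : Frac) : List (Option Bool) :=
  some (decide (q.num < 0)) :: (encodeNatSep q.num.natAbs ++ encodeNatSep q.den)

/-- An instance of the evaluation problem of (UP) with interval uncertainty and rational data:
midpoints `chat`, deviations `d ≥ 0`, and the solution `x` to be evaluated. -/
structure EvalInstance where
  n : ℕ
  chat : Fin n → Frac
  d : Fin n → Frac
  d_nonneg : ∀ i, 0 ≤ (d i).num
  x : Fin n → Bool

/-- The regret of the solution that is given in the instance. -/
def EvalInstance.regret (I : EvalInstance) : ℝ :=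
  MinmaxRegret.regret (binaryCube I.n) (hyperbox (fun i => (I.chat i).val) (fun i => (I.d i).val))
    (fun i => if I.x i then 1 else 0)

/-- The bit `x_i` followed by `chat_i` and `d_i`, for `i = 0, …, n - 1`. -/
def encodeInstance (I : EvalInstance) : List (Option Bool) :=
  (List.finRange I.n).flatMap fun i =>
    some (I.x i) :: (encodeFrac (I.chat i) ++ encodeFrac (I.d i))

/-- An instance together with a threshold for the decision version. -/
def encodeInstanceThreshold (p : EvalInstance × Frac) : List (Option Bool) :=
  encodeFrac p.2 ++ encodeInstance p.1

/-! ### Polynomial time -/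

/-- The real-valued function `r` on instances takes rational values, and some Turing machine that
runs in time polynomial in the length of the encoding writes down `r a` as a binary fraction. -/
def PolyTimeEvaluable {α Γ : Type} (enc : α → List Γ) (r : α → ℝ) : Prop :=
  ∃ g : α → Frac, (∀ a, (g a).val = r a) ∧
    Nonempty (Turing.TM2ComputableInPolyTime enc encodeFrac g)

open Classical in
/-- The decision problem with set `L` of yes-instances is in P: some Turing machine decides it in
time polynomial in the length of the encoding. -/
def InP {α Γ : Type} (enc : α → List Γ) (L : Set α) : Prop :=
  Nonempty (Turing.TM2ComputableInPolyTime enc Computability.encodeBool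
    (fun a => decide (a ∈ L)))

end

end MinmaxRegret

namespace MinmaxRegret

/-! ### The closed form of the regret -/

/-! Closed form. Over the cube the inner minimum separates: take `y i = 1` exactly where `c i ≤ 0`,
so the optimum is the sum of `min 0 (c i)`. For fixed `x` the regret under `c` is then a sum of
terms `max 0 (-c i)` (if `x i = 0`) or `max 0 (c i)` (if `x i = 1`). Each is monotone in `c i`,
hence largest at an endpoint of its interval, and a box allows all these endpoints at once; this is
the worst scenario. The resulting contribution of a coordinate is `regretTerm`, and `regret_eq_sum`
is the formula on which both algorithms rest.

Real arithmetic. `regretProgram` adds up these terms in one pass, with at most 16 steps per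
coordinate and 2 steps to leave the loop.

Turing machines. The terms are added as fractions without cancellation (`addItem`). Multiplying
numbers adds their lengths, so numerator and denominator keep length linear in the input
(`itemBounds`, `foldl_addItem_lt`), and no gcd is needed. It remains to run schoolbook arithmetic on
a multi-stack machine. Machines are assembled from fragments with several exits by `bind` and
`iter`; `Exec` records exit, final stacks and a time bound, and `Exec.bind`, `Exec.iter_exit` and
`Exec.iter_next` make it compositional. Addition and subtraction share one carry loop
(`exec_combine`), multiplication is Horner's scheme (`exec_mulBy`) in quadratic time. With linearly
many coordinates the total is cubic. The decision version cross-multiplies the computed fraction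
with the threshold (`regret_threshold_iff`). -/

theorem isLeast_binaryCube {n : ℕ} (c : Fin n → ℝ) :
    IsLeast ((fun y => c ⬝ᵥ y) '' binaryCube n) (∑ i, min 0 (c i)) := by
  constructor
  · refine ⟨fun i => if c i ≤ 0 then 1 else 0, fun i => ?_, ?_⟩
    · by_cases h : c i ≤ 0 <;> simp [h]
    · refine Finset.sum_congr rfl fun i _ => ?_
      by_cases h : c i ≤ 0
      · simp [h]
      · simp [h, (not_le.1 h).le]
  · rintro _ ⟨y, hy, rfl⟩
    refine Finset.sum_le_sum fun i _ => ?_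
    rcases hy i with h | h <;> simp [h]

theorem opt_binaryCube {n : ℕ} (c : Fin n → ℝ) : opt (binaryCube n) c = ∑ i, min 0 (c i) :=
  (isLeast_binaryCube c).csInf_eq

/-- The contribution of one coordinate to the regret. -/
noncomputable def regretTerm (chat d x : ℝ) : ℝ := max 0 (d + (2 * x - 1) * chat)

theorem regretTerm_eq (chat d : ℝ) {x : ℝ} (hx : x = 0 ∨ x = 1) :
    (chat + (2 * x - 1) * d) * x - min 0 (chat + (2 * x - 1) * d) = regretTerm chat d x := by
  unfold regretTerm
  rcases hx with rfl | rfl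
  · rcases le_total chat d with h | h
    · rw [min_eq_right (by linarith), max_eq_right (by linarith)]; ring
    · rw [min_eq_left (by linarith), max_eq_left (by linarith)]; ring
  · rcases le_total 0 (chat + d) with h | h
    · rw [min_eq_left (by linarith), max_eq_right (by linarith)]; ring
    · rw [min_eq_right (by linarith), max_eq_left (by linarith)]; ring

/-- The left side is `max 0 (-c)` for `x = 0` and `max 0 c` for `x = 1`. By monotonicity only the
lower or only the upper endpoint of the interval matters. -/
theorem sub_min_le_regretTerm {chat d c x : ℝ} (hx : x = 0 ∨ x = 1)
    (hc : c ∈ Set.Icc (chat - d) (chat + d)) : c * x - min 0 c ≤ regretTerm chat d x := by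
  obtain ⟨h₁, h₂⟩ := hc
  unfold regretTerm
  rcases hx with rfl | rfl
  · rcases le_total 0 c with h | h
    · rw [min_eq_left h]; simp
    · rw [min_eq_right h]; exact le_max_of_le_right (by linarith)
  · rcases le_total 0 c with h | h
    · rw [min_eq_left h]; exact le_max_of_le_right (by linarith)
    · rw [min_eq_right h]; simp

/-- The coordinatewise bounds are attained simultaneously by `worstScenario`, which lies in the box
because `d` is nonnegative. -/
theorem isGreatest_regretValues {n : ℕ} {chat d x : Fin n → ℝ} (hd : ∀ i, 0 ≤ d i)
    (hx : x ∈ binaryCube n) :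
    IsGreatest (regretValues (binaryCube n) (hyperbox chat d) x)
      (∑ i, regretTerm (chat i) (d i) (x i)) := by
  constructor
  · refine ⟨worstScenario chat d x, fun i _ => ?_, ?_⟩
    · have := hd i
      rcases hx i with h | h <;> simp only [worstScenario, h, Set.mem_Icc] <;>
        constructor <;> linarith
    · simp only [opt_binaryCube, dotProduct, ← Finset.sum_sub_distrib]
      exact Finset.sum_congr rfl fun i _ => regretTerm_eq _ _ (hx i)
  · rintro _ ⟨c, hc, rfl⟩
    simp only [opt_binaryCube, dotProduct, ← Finset.sum_sub_distrib]
    exact Finset.sum_le_sum fun i _ => sub_min_le_regretTerm (hx i) (hc i trivial)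

theorem regret_eq_sum {n : ℕ} {chat d x : Fin n → ℝ} (hd : ∀ i, 0 ≤ d i)
    (hx : x ∈ binaryCube n) :
    regret (binaryCube n) (hyperbox chat d) x = ∑ i, regretTerm (chat i) (d i) (x i) :=
  (isGreatest_regretValues hd hx).csSup_eq

theorem regret_closed_form {n : ℕ} {chat d x : Fin n → ℝ} (hd : ∀ i, 0 ≤ d i)
    (hx : x ∈ binaryCube n) :
    (∀ c : Fin n → ℝ, IsLeast ((fun y => c ⬝ᵥ y) '' binaryCube n) (opt (binaryCube n) c)) ∧
    IsGreatest (regretValues (binaryCube n) (hyperbox chat d) x)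
      (regret (binaryCube n) (hyperbox chat d) x) ∧
    regret (binaryCube n) (hyperbox chat d) x =
      ∑ i, worstScenario chat d x i * x i - ∑ i, min 0 (worstScenario chat d x i) := by
  refine ⟨fun c => opt_binaryCube c ▸ isLeast_binaryCube c,
    regret_eq_sum hd hx ▸ isGreatest_regretValues hd hx, ?_⟩
  rw [regret_eq_sum hd hx, ← Finset.sum_sub_distrib]
  exact Finset.sum_congr rfl fun i _ => (regretTerm_eq _ _ (hx i)).symm

/-! ### A linear-time program for the random access machine -/

/-- Real register `0` accumulates the regret, index register `1` runs through the memory and index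
register `2` counts the processed coordinates. -/
def regretProgram : List RamInstr :=
  [.idxJumpLt 2 0 2, .jump 17,
   .load 1 1, .idxInc 1, .load 2 1, .idxInc 1, .load 3 1, .idxInc 1, .idxInc 2,
   .add 3 3 3, .const 4 1, .sub 3 3 4, .mul 1 1 3, .add 1 2 1,
   .jumpLe 1 5 0, .add 0 0 1, .jump 0]

theorem ramStep_iterate_loop (c : RamConfig) (hpc : c.pc = 0) (hlt : c.idx 2 < c.idx 0)
    (h5 : c.reg 5 = 0) :
    ∃ t ≤ 16, ∃ c', (ramStep regretProgram)^[t] c = c' ∧ c'.pc = 0 ∧ c'.idx 0 = c.idx 0 ∧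
      c'.idx 1 = c.idx 1 + 3 ∧ c'.idx 2 = c.idx 2 + 1 ∧ c'.reg 5 = 0 ∧ c'.mem = c.mem ∧
      c'.reg 0 = c.reg 0 +
        regretTerm (c.mem (c.idx 1)) (c.mem (c.idx 1 + 1)) (c.mem (c.idx 1 + 2)) := by
  obtain ⟨pc, idx, reg, mem⟩ := c
  simp only at hpc hlt h5
  subst hpc
  unfold regretTerm
  -- The program never writes register `5`, so it supplies the constant `0` for the comparison. A
  -- nonpositive term jumps back after 14 steps; otherwise two more instructions add it and return.
  by_cases h : mem (idx 1 + 1) + mem (idx 1) * (mem (idx 1 + 2) + mem (idx 1 + 2) - 1) ≤ 0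
  · refine ⟨14, by norm_num, _, rfl, ?_⟩
    rw [max_eq_left (by linarith)]
    simp [ramStep, RamInstr.exec, regretProgram, hlt, h5, h, add_assoc]
  · refine ⟨16, by norm_num, _, rfl, ?_⟩
    rw [max_eq_right (by linarith)]
    simp [ramStep, RamInstr.exec, regretProgram, hlt, h5, h, add_assoc]
    ring

theorem ramStep_iterate_sum {n : ℕ} (chat d x : Fin n → ℝ) (k : ℕ) (hk : k ≤ n) :
    ∃ t ≤ 16 * k, ∃ c', (ramStep regretProgram)^[t] (ramInit chat d x) = c' ∧ c'.pc = 0 ∧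
      c'.idx 0 = n ∧ c'.idx 1 = 3 * k ∧ c'.idx 2 = k ∧ c'.reg 5 = 0 ∧
      c'.mem = (ramInit chat d x).mem ∧
      c'.reg 0 = ∑ i : Fin k, regretTerm (chat (i.castLE hk)) (d (i.castLE hk))
        (x (i.castLE hk)) := by
  induction k with
  | zero => exact ⟨0, le_rfl, _, rfl, by simp [ramInit]⟩
  | succ k ih =>
    obtain ⟨t, ht, c, hc, h1, h2, h3, h4, h5, h6, h7⟩ := ih (by omega)
    obtain ⟨t', ht', c', hc', h1', h2', h3', h4', h5', h6', h7'⟩ :=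
      ramStep_iterate_loop c h1 (by omega) h5
    refine ⟨t' + t, by omega, c', by rw [Function.iterate_add_apply, hc, hc'], h1', by omega,
      by omega, by omega, h5', h6'.trans h6, ?_⟩
    have e1 : 3 * k / 3 = k := by omega
    have e2 : (3 * k + 1) / 3 = k := by omega
    have e3 : (3 * k + 2) / 3 = k := by omega
    have e4 : (3 * k + 1) % 3 = 1 := by omega
    have e5 : (3 * k + 2) % 3 = 2 := by omega
    rw [h7', h7, Fin.sum_univ_castSucc, h6, h3]
    simp only [ramInit, e1, e2, e3, e4, e5, dif_pos (show k < n by omega)]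
    simp [Fin.castLE]

theorem ramStep_iterate_of_length_le {P : List RamInstr} {c : RamConfig} (h : P.length ≤ c.pc)
    (t : ℕ) : (ramStep P)^[t] c = c :=
  Function.iterate_fixed (by simp [ramStep, List.getElem?_eq_none h]) t

theorem ramOutputsWithin_regretProgram {n : ℕ} (chat d x : Fin n → ℝ) :
    RamOutputsWithin regretProgram (ramInit chat d x) (16 * (n + 1))
      (∑ i, regretTerm (chat i) (d i) (x i)) := by
  obtain ⟨t, ht, c, hc, h1, h2, -, h4, -, -, h7⟩ := ramStep_iterate_sum chat d x n le_rfl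
  have hfinish : ∃ c', (ramStep regretProgram)^[2] c = c' ∧ c'.pc = 17 ∧ c'.reg 0 = c.reg 0 := by
    refine ⟨_, rfl, ?_⟩
    obtain ⟨pc, idx, reg, mem⟩ := c
    simp only at h1 h2 h4
    subst h1
    simp [ramStep, RamInstr.exec, regretProgram, h2, h4]
  obtain ⟨c', hc', hpc, hreg⟩ := hfinish
  have hfin : (ramStep regretProgram)^[16 * (n + 1)] (ramInit chat d x) = c' := by
    -- `t` steps for the loop and 2 to leave it; in the other `s` steps the halted configuration
    -- stays fixed.
    obtain ⟨s, hs⟩ : ∃ s, 16 * (n + 1) = s + (2 + t) := ⟨16 * (n + 1) - (2 + t), by omega⟩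
    rw [hs, Function.iterate_add_apply, Function.iterate_add_apply, hc, hc',
      ramStep_iterate_of_length_le (by simp [regretProgram, hpc])]
  refine ⟨by rw [hfin, hpc]; simp [regretProgram], ?_⟩
  rw [hfin, hreg, h7]
  simp

open Turing

/-! ### Program fragments for multi-stack machines

A fragment is a piece of a `TM2` machine that is entered at one label and left through one of
several exits. The machine's internal state only buffers the symbol popped last. -/

/-- Change the labels and embed the stacks of a statement into a family with one more stack. -/
def liftStmt {K Γ O Λ Λ' : Type} (f : Λ → Λ') :
    TM2.Stmt (fun _ : K => Γ) Λ (Option Γ) →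
      TM2.Stmt (fun k : Option K => k.elim O fun _ => Γ) Λ' (Option Γ)
  | .push k a q => .push (some k) a (liftStmt f q)
  | .peek k a q => .peek (some k) a (liftStmt f q)
  | .pop k a q => .pop (some k) a (liftStmt f q)
  | .load a q => .load a (liftStmt f q)
  | .branch b q₁ q₂ => .branch b (liftStmt f q₁) (liftStmt f q₂)
  | .goto l => .goto fun v => f (l v)
  | .halt => .halt

/-- Change the labels of a statement. -/
def mapStmt {K Γ Λ Λ' : Type} (f : Λ → Λ') :
    TM2.Stmt (fun _ : K => Γ) Λ (Option Γ) → TM2.Stmt (fun _ : K => Γ) Λ' (Option Γ)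
  | .push k a q => .push k a (mapStmt f q)
  | .peek k a q => .peek k a (mapStmt f q)
  | .pop k a q => .pop k a (mapStmt f q)
  | .load a q => .load a (mapStmt f q)
  | .branch b q₁ q₂ => .branch b (mapStmt f q₁) (mapStmt f q₂)
  | .goto l => .goto fun v => f (l v)
  | .halt => .halt

/-- A program fragment with exits `E`. -/
structure Frag (K Γ E : Type) where
  Λ : Type
  fin : Finite Λ
  entry : Λ
  code : Λ → TM2.Stmt (fun _ : K => Γ) (Λ ⊕ E) (Option Γ)

namespace Frag

variable {K Γ E E' Q : Type}

/-- A configuration with all stacks over the same alphabet. -/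
abbrev Config (K Γ L : Type) := TM2.Cfg (fun _ : K => Γ) L (Option Γ)

/-- Change the label of a configuration. -/
def relabel {L L' : Type} (f : L → L') (c : Config K Γ L) : Config K Γ L' :=
  ⟨c.l.map f, c.var, c.stk⟩

/-- Labels enter a statement only through `goto`, so renaming them commutes with execution. -/
theorem stepAux_mapStmt [DecidableEq K] {L L' : Type} (f : L → L')
    (q : TM2.Stmt (fun _ : K => Γ) L (Option Γ)) (v : Option Γ) (S : K → List Γ) :
    TM2.stepAux (mapStmt f q) v S = relabel f (TM2.stepAux q v S) := by
  induction q generalizing v S with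
  | branch b q₁ q₂ h₁ h₂ => cases h : b v <;> simp [mapStmt, TM2.stepAux, h, h₁, h₂]
  | goto => simp [mapStmt, TM2.stepAux, relabel]
  | halt => simp [mapStmt, TM2.stepAux, relabel]
  | _ => simp_all [mapStmt, TM2.stepAux]

/-- `F.Run n c c'`: the fragment gets from `c` to `c'` in `n` steps. -/
inductive Run [DecidableEq K] (F : Frag K Γ E) :
    ℕ → Config K Γ (F.Λ ⊕ E) → Config K Γ (F.Λ ⊕ E) → Prop
  | refl (c) : Run F 0 c c
  | step {n l v S c} : Run F n (TM2.stepAux (F.code l) v S) c →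
      Run F (n + 1) ⟨some (.inl l), v, S⟩ c

theorem Run.trans [DecidableEq K] {F : Frag K Γ E} {m n : ℕ} {c₁ c₂ c₃}
    (h₁ : F.Run m c₁ c₂) (h₂ : F.Run n c₂ c₃) : F.Run (m + n) c₁ c₃ := by
  induction h₁ with
  | refl => simpa using h₂
  | step _ ih => rw [Nat.add_right_comm]; exact .step (ih h₂)

/-- The simulation principle behind `bind` and `iter`: `f` keeps the inner labels inside `G`, but is
free to send an exit of `F` to the entry of whatever follows. -/
theorem Run.map [DecidableEq K] {F : Frag K Γ E} {G : Frag K Γ E'} (f : F.Λ ⊕ E → G.Λ ⊕ E')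
    (g : F.Λ → G.Λ) (hg : ∀ l, f (.inl l) = .inl (g l))
    (hc : ∀ l, G.code (g l) = mapStmt f (F.code l)) {n : ℕ} {c c'} (h : F.Run n c c') :
    G.Run n (relabel f c) (relabel f c') := by
  induction h with
  | refl => exact .refl _
  | step _ ih =>
    simp only [relabel, Option.map_some, hg]
    refine .step ?_
    rw [hc, stepAux_mapStmt]
    exact ih

/-- Started on stacks `S`, the fragment is left through exit `e` with stacks `S'` after at most `t`
steps. -/
def Exec [DecidableEq K] (F : Frag K Γ E) (S : K → List Γ) (t : ℕ) (e : E) (S' : K → List Γ) :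
    Prop :=
  ∀ v, ∃ n ≤ t, ∃ v', F.Run n ⟨some (.inl F.entry), v, S⟩ ⟨some (.inr e), v', S'⟩

/-- Leave through the exit `e`. -/
def pure (e : E) : Frag K Γ E := ⟨Unit, inferInstance, (), fun _ => .goto fun _ => .inr e⟩

/-- Push a symbol. -/
def push (k : K) (a : Γ) : Frag K Γ Unit :=
  ⟨Unit, inferInstance, (), fun _ => .push k (fun _ => a) (.goto fun _ => .inr ())⟩

/-- Pop a symbol and leave through the exit that it names. -/
def pop (k : K) : Frag K Γ (Option Γ) :=
  ⟨Unit, inferInstance, (), fun _ => .pop k (fun _ a => a) (.goto fun a => .inr a)⟩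

/-- Continue with `G e` when `F` is left through `e`. -/
def bind [Finite E] (F : Frag K Γ E) (G : E → Frag K Γ E') : Frag K Γ E' where
  Λ := F.Λ ⊕ Σ e, (G e).Λ
  fin := by
    have := F.fin
    have := fun e => (G e).fin
    infer_instance
  entry := .inl F.entry
  code
    | .inl l => mapStmt (Sum.elim (fun l => .inl (.inl l)) fun e => .inl (.inr ⟨e, (G e).entry⟩))
        (F.code l)
    | .inr ⟨e, l⟩ => mapStmt (Sum.elim (fun l => .inl (.inr ⟨e, l⟩)) .inr) ((G e).code l)

/-- Repeat `F`, which returns either the next loop state or an exit. -/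
def iter [Finite Q] (F : Q → Frag K Γ (Q ⊕ E)) (q : Q) : Frag K Γ E where
  Λ := Σ q, (F q).Λ
  fin := by
    have := fun q => (F q).fin
    infer_instance
  entry := ⟨q, (F q).entry⟩
  code := fun ⟨q, l⟩ => mapStmt (Sum.elim (fun l => .inl ⟨q, l⟩)
    (Sum.elim (fun q' => .inl ⟨q', (F q').entry⟩) .inr)) ((F q).code l)

section Exec

variable [DecidableEq K] {S S' S'' : K → List Γ} {t t' : ℕ} {e : E} {e' : E'}

theorem Exec.mono {F : Frag K Γ E} (h : F.Exec S t e S') (ht : t ≤ t') : F.Exec S t' e S' :=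
  fun v => let ⟨n, hn, w⟩ := h v; ⟨n, hn.trans ht, w⟩

theorem exec_pure : (pure e : Frag K Γ E).Exec S 1 e S :=
  fun v => ⟨1, le_rfl, v, .step (by simpa [pure] using Run.refl _)⟩

theorem exec_push (k : K) (a : Γ) :
    (push k a).Exec S 1 () (Function.update S k (a :: S k)) :=
  fun v => ⟨1, le_rfl, v, .step (by simpa [push] using Run.refl _)⟩

theorem exec_pop (k : K) :
    (pop k).Exec S 1 (S k).head? (Function.update S k (S k).tail) :=
  fun _ => ⟨1, le_rfl, (S k).head?, .step (by simpa [pop] using Run.refl _)⟩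

theorem Exec.bind [Finite E] {F : Frag K Γ E} {G : E → Frag K Γ E'} (h : F.Exec S t e S')
    (h' : (G e).Exec S' t' e' S'') : (F.bind G).Exec S (t + t') e' S'' := by
  intro v
  obtain ⟨n, hn, w, hw⟩ := h v
  obtain ⟨n', hn', w', hw'⟩ := h' w
  refine ⟨n + n', add_le_add hn hn', w', ?_⟩
  have r := hw.map (G := F.bind G)
    (Sum.elim (fun l => .inl (.inl l)) fun e => .inl (.inr ⟨e, (G e).entry⟩)) .inl
    (fun _ => rfl) (fun _ => rfl)
  have r' := hw'.map (G := F.bind G) (Sum.elim (fun l => .inl (.inr ⟨e, l⟩)) .inr)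
    (fun l => .inr ⟨e, l⟩) (fun _ => rfl) (fun _ => rfl)
  exact r.trans r'

theorem Exec.iter_exit [Finite Q] {F : Q → Frag K Γ (Q ⊕ E)} {q : Q}
    (h : (F q).Exec S t (.inr e) S') : (iter F q).Exec S t e S' := by
  intro v
  obtain ⟨n, hn, w, hw⟩ := h v
  exact ⟨n, hn, w, hw.map (G := iter F q) (Sum.elim (fun l => .inl ⟨q, l⟩)
    (Sum.elim (fun q' => .inl ⟨q', (F q').entry⟩) .inr)) (fun l => ⟨q, l⟩)
    (fun _ => rfl) (fun _ => rfl)⟩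

/-- `iter F q` and `iter F q'` have the same labels and code and differ only in the entry, so a run
of one is a run of the other. -/
theorem Run.iter_entry [Finite Q] {F : Q → Frag K Γ (Q ⊕ E)} {q' : Q} {n : ℕ} {c c'}
    (h : (iter F q').Run n c c') (q : Q) : (iter F q).Run n c c' := by
  induction h with
  | refl => exact .refl _
  | step _ ih => exact .step ih

theorem Exec.iter_next [Finite Q] {F : Q → Frag K Γ (Q ⊕ E)} {q q' : Q}
    (h : (F q).Exec S t (.inl q') S') (h' : (iter F q').Exec S' t' e S'') :
    (iter F q).Exec S (t + t') e S'' := by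
  intro v
  obtain ⟨n, hn, w, hw⟩ := h v
  obtain ⟨n', hn', w', hw'⟩ := h' w
  refine ⟨n + n', add_le_add hn hn', w', ?_⟩
  have r := hw.map (G := iter F q) (Sum.elim (fun l => .inl ⟨q, l⟩)
    (Sum.elim (fun q' => .inl ⟨q', (F q').entry⟩) .inr)) (fun l => ⟨q, l⟩)
    (fun _ => rfl) (fun _ => rfl)
  exact r.trans (hw'.iter_entry q)

end Exec

/-! ### Complete machines -/

/-- The stacks together with one additional stack over a separate alphabet. -/
def extend {O : Type} (o : List O) (S : K → List Γ) :
    ∀ k : Option K, List (k.elim O fun _ => Γ)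
  | none => o
  | some k => S k

theorem extend_update [DecidableEq K] {O : Type} (o : List O) (S : K → List Γ) (k : K)
    (l : List Γ) : Function.update (extend o S) (some k) l = extend o (Function.update S k l) := by
  funext j
  cases j with
  | none => exact Function.update_of_ne (by simp) _ _
  | some j =>
    by_cases h : j = k
    · subst h
      exact (Function.update_self _ _ _).trans (Function.update_self j l S).symm
    · exact (Function.update_of_ne (by simpa using h) _ _).trans (by simp [extend, h])

/-- Embed a configuration into the machine with the additional stack. -/
def liftConfig {O L L' : Type} (f : L → L') (c : Config K Γ L) :
    TM2.Cfg (fun k : Option K => k.elim O fun _ => Γ) L' (Option Γ) :=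
  ⟨c.l.map f, c.var, extend [] c.stk⟩

/-- A lifted statement addresses only stacks `some k`, so the additional stack stays empty while the
fragment runs. -/
theorem stepAux_liftStmt [DecidableEq K] {O L L' : Type} (f : L → L')
    (q : TM2.Stmt (fun _ : K => Γ) L (Option Γ)) (v : Option Γ) (S : K → List Γ) :
    TM2.stepAux (liftStmt (O := O) f q) v (extend [] S) = liftConfig f (TM2.stepAux q v S) := by
  induction q generalizing v S with
  | push k a q ih =>
    simp only [liftStmt, TM2.stepAux]
    rw [← ih, ← extend_update]; rfl
  | pop k a q ih =>
    simp only [liftStmt, TM2.stepAux]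
    rw [← ih, ← extend_update]; rfl
  | peek k a q ih =>
    simp only [liftStmt, TM2.stepAux]
    rw [← ih]; rfl
  | load a q ih =>
    simp only [liftStmt, TM2.stepAux]
    rw [← ih]
  | branch b q₁ q₂ h₁ h₂ => cases h : b v <;> simp [liftStmt, TM2.stepAux, h, h₁, h₂]
  | goto => simp [liftStmt, TM2.stepAux, liftConfig]
  | halt => simp [liftStmt, TM2.stepAux, liftConfig]

/-- The machine that runs a fragment, writes the optional answer `out e` to the additional stack and
halts. -/
noncomputable def toMachine {K E O : Type} [DecidableEq K] [Fintype K] {Γ : Type} [Fintype Γ]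
    [Finite E] (F : Frag K Γ E) (out : E → Option O) (k₀ : K) (k₁ : Option K) : FinTM2 where
  K := Option K
  k₀ := some k₀
  k₁ := k₁
  Γ := fun k => k.elim O fun _ => Γ
  Λ := F.Λ ⊕ E
  main := .inl F.entry
  ΛFin := by
    have := F.fin
    exact Fintype.ofFinite _
  σ := Option Γ
  initialState := none
  Γk₀Fin := inferInstanceAs (Fintype Γ)
  m
    | .inl l => liftStmt id (F.code l)
    | .inr e => match out e with
      | none => .load (fun _ => none) .halt
      | some b => .push none (fun _ => b) (.load (fun _ => none) .halt)

theorem Run.toMachine {O : Type} [DecidableEq K] [Fintype K] [Fintype Γ] [Finite E]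
    {F : Frag K Γ E} (out : E → Option O) (k₀ : K) (k₁ : Option K) {n : ℕ} {c c'}
    (h : F.Run n c c') :
    (flip Option.bind (F.toMachine out k₀ k₁).step)^[n] (some (liftConfig id c)) =
      some (liftConfig id c') := by
  induction h with
  | refl => rfl
  | @step n l v S c _ ih =>
    rw [Function.iterate_succ_apply]
    refine Eq.trans (congrArg _ ?_) ih
    exact congrArg some (stepAux_liftStmt (O := O) id (F.code l) v S)

/-- The extra step executes the exit label. It also resets the buffer to `none`, since a halting
configuration must carry the initial internal state. -/
theorem Exec.toMachine {O : Type} [DecidableEq K] [Fintype K] [Fintype Γ] [Finite E]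
    {F : Frag K Γ E} (out : E → Option O) (k₀ : K) (k₁ : Option K)
    {S S' : K → List Γ} {t : ℕ} {e : E} (h : F.Exec S t e S') :
    ∃ n ≤ t + 1, (flip Option.bind (F.toMachine out k₀ k₁).step)^[n]
      (some ⟨some (.inl F.entry), none, extend [] S⟩) =
        some ⟨none, none, extend (out e).toList S'⟩ := by
  obtain ⟨n, hn, v, hr⟩ := h none
  refine ⟨n + 1, by omega, ?_⟩
  have := hr.toMachine out k₀ k₁
  rw [Nat.add_comm, Function.iterate_add_apply]
  refine (congrArg _ this).trans ?_
  rw [Function.iterate_one]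
  change some (TM2.stepAux ((F.toMachine out k₀ k₁).m (.inr e)) v (extend [] S')) = _
  simp only [Frag.toMachine]
  cases h : out e with
  | none => rfl
  | some b =>
    simp only [TM2.stepAux, Option.toList]
    congr 2
    funext k
    cases k with
    | none => exact Function.update_self _ _ _
    | some k => exact Function.update_of_ne (by simp) _ _

end Frag

/-! ### Binary numbers as lists of bits -/

/-- The number with the given binary digits, least significant digit first. -/
def bitsVal (l : List Bool) : ℕ := l.foldr Nat.bit 0

@[simp] theorem bitsVal_nil : bitsVal [] = 0 := rfl

@[simp] theorem bitsVal_cons (b : Bool) (l : List Bool) :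
    bitsVal (b :: l) = Nat.bit b (bitsVal l) := rfl

theorem bitsVal_bits (n : ℕ) : bitsVal n.bits = n := by
  induction n using Nat.binaryRec' with
  | zero => simp
  | bit b n h ih => rw [Nat.bits_append_bit n b h, bitsVal_cons, ih]

theorem bitsVal_lt (l : List Bool) : bitsVal l < 2 ^ l.length := by
  induction l with
  | nil => simp
  | cons b l ih =>
    rw [bitsVal_cons, List.length_cons, pow_succ, Nat.bit_val]
    cases b <;> simp <;> omega

theorem bitsVal_append (l l' : List Bool) :
    bitsVal (l ++ l') = bitsVal l + 2 ^ l.length * bitsVal l' := by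
  induction l with
  | nil => simp
  | cons b l ih =>
    simp only [List.cons_append, bitsVal_cons, ih, List.length_cons, Nat.bit_val, pow_succ]
    ring

theorem bitsVal_eq_head_tail (l : List Bool) :
    bitsVal l = (l.headD false).toNat + 2 * bitsVal l.tail := by
  cases l <;> simp [Nat.bit_val, add_comm]

theorem bits_bit (b : Bool) (n : ℕ) :
    (Nat.bit b n).bits = if n = 0 ∧ b = false then [] else b :: n.bits := by
  split_ifs with h
  · obtain ⟨rfl, rfl⟩ := h; simp
  · exact Nat.bits_append_bit n b (by simpa using h)

/-- The stack content for the natural number `m`. -/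
def natWord (m : ℕ) : List (Option Bool) := m.bits.map some

theorem length_natWord (m : ℕ) : (natWord m).length = m.size := by
  simp [natWord, Nat.size_eq_bits_len]

theorem length_natWord_le {m k : ℕ} : (natWord m).length ≤ k ↔ m < 2 ^ k := by
  rw [length_natWord, Nat.size_le]

theorem natWord_eq (m : ℕ) : ∃ l : List Bool, natWord m = l.map some ∧ bitsVal l = m :=
  ⟨m.bits, rfl, bitsVal_bits m⟩

namespace Frag

/-! ### Subroutines -/

section Subroutines

variable {K : Type}

/-- Move stack `a` to stack `b`, which reverses it. -/
def moveTo {Γ : Type} [Finite Γ] (a b : K) : Frag K Γ Unit :=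
  iter (Q := Unit) (fun _ => (pop a).bind fun
    | none => pure (.inr ())
    | some s => (push b s).bind fun _ => pure (.inl ())) ()

/-- Empty the stack `a`. -/
def clear {Γ : Type} [Finite Γ] (a : K) : Frag K Γ Unit :=
  iter (Q := Unit) (fun _ => (pop a).bind fun
    | none => pure (.inr ())
    | some _ => pure (.inl ())) ()

/-- Move stack `a` to stack `b` without the zeros on top of `a`. -/
def trimTo (a b : K) (started : Bool) : Frag K (Option Bool) Unit :=
  iter (Q := Bool) (fun q => (pop a).bind fun
    | none => pure (.inr ())
    | some s => if q = false ∧ s = some false then pure (.inl false) else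
        (push b s).bind fun _ => pure (.inl true)) started

/-- Read the symbols on stack `a` up to and including the first separator onto stack `b`. -/
def readTo (a b : K) : Frag K (Option Bool) Unit :=
  iter (Q := Unit) (fun _ => (pop a).bind fun
    | some (some s) => (push b (some s)).bind fun _ => pure (.inl ())
    | _ => pure (.inr ())) ()

variable [DecidableEq K]

theorem Exec.congr {Γ E : Type} {F : Frag K Γ E} {S S' S'' : K → List Γ} {t t' : ℕ} {e e' : E}
    (h : F.Exec S t e S') (ht : t ≤ t') (he : e = e') (hS : S' = S'') : F.Exec S t' e' S'' := by
  subst he hS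
  exact h.mono ht

theorem exec_pop_nil {Γ : Type} {S : K → List Γ} {a : K} (h : S a = []) :
    (pop a).Exec S 1 none S :=
  (exec_pop a).congr le_rfl (by simp [h]) (by rw [h, List.tail_nil, ← h, Function.update_eq_self])

theorem exec_pop_cons {Γ : Type} {S : K → List Γ} {a : K} {s : Γ} {l : List Γ}
    (h : S a = s :: l) : (pop a).Exec S 1 (some s) (Function.update S a l) :=
  (exec_pop a).congr le_rfl (by simp [h]) (by simp [h])

/-- Each symbol costs a pop, a push and the jump back; the constant pays for the failing pop and the
exit. -/
theorem exec_moveTo {Γ : Type} [Finite Γ] {a b : K} (hab : a ≠ b) (l : List Γ) (S : K → List Γ)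
    (h : S a = l) :
    (moveTo a b).Exec S (3 * l.length + 2) ()
      (Function.update (Function.update S a []) b (l.reverse ++ S b)) := by
  induction l generalizing S with
  | nil =>
    refine Exec.congr (Exec.iter_exit (Exec.bind (exec_pop_nil h) exec_pure)) (by simp) rfl ?_
    funext j; grind
  | cons s l ih =>
    refine Exec.congr (Exec.iter_next (Exec.bind (exec_pop_cons h)
      (Exec.bind (exec_push b s) exec_pure)) (ih _ ?_)) (by simp; omega) rfl ?_
    · grind
    · funext j; grind

theorem exec_clear {Γ : Type} [Finite Γ] (a : K) (l : List Γ) (S : K → List Γ) (h : S a = l) :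
    (clear a).Exec S (2 * l.length + 2) () (Function.update S a []) := by
  induction l generalizing S with
  | nil =>
    refine Exec.congr (Exec.iter_exit (Exec.bind (exec_pop_nil h) exec_pure)) (by simp) rfl ?_
    funext j; grind
  | cons s l ih =>
    refine Exec.congr (Exec.iter_next (Exec.bind (exec_pop_cons h) exec_pure)
      (ih _ ?_)) (by simp; omega) rfl ?_
    · grind
    · funext j; grind

/-- Stack `a` has its most significant digit on top, so every digit moved to `b` acts as `Nat.bit`
on the number `n` there. That number remains canonical because a zero is dropped as long as `n = 0`;
the loop state is exactly the truth value of `n ≠ 0`. -/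
theorem exec_trimTo_aux {a b : K} (hab : a ≠ b) (l : List Bool) (n : ℕ)
    (S : K → List (Option Bool)) (ha : S a = l.map some) (hb : S b = natWord n) :
    (trimTo a b (decide (n ≠ 0))).Exec S (3 * l.length + 2) ()
      (Function.update (Function.update S a []) b
        (natWord (l.foldl (fun n b => Nat.bit b n) n))) := by
  induction l generalizing S n with
  | nil =>
    refine Exec.congr (Exec.iter_exit (Exec.bind (exec_pop_nil ha) exec_pure)) (by simp) rfl ?_
    funext j; grind
  | cons s l ih =>
    by_cases hs : n = 0 ∧ s = false
    · obtain ⟨rfl, rfl⟩ := hs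
      refine Exec.congr (Exec.iter_next (Exec.bind (e' := Sum.inl false) (t' := 1)
        (exec_pop_cons ha) exec_pure)
        (ih 0 (Function.update S a (l.map some)) (by simp) (by grind)))
        (by simp; omega) rfl ?_
      · funext j; simp
    · have hn : Nat.bit s n ≠ 0 := by
        rw [Nat.bit_val]; cases s <;> simp_all
      have hw : natWord (Nat.bit s n) = some s :: natWord n := by
        simp [natWord, bits_bit, hs]
      have ih' := ih (Nat.bit s n)
        (Function.update (Function.update S a (l.map some)) b (some s :: natWord n))
        (by grind) (by grind)
      rw [decide_eq_true hn] at ih'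
      refine Exec.congr (Exec.iter_next (Exec.bind (e' := Sum.inl true) (t' := 2)
        (exec_pop_cons ha) ?_) ih') (by simp; omega) rfl ?_
      · dsimp only
        rw [if_neg (by simpa using hs)]
        refine Exec.congr (Exec.bind (exec_push b (some s)) exec_pure) le_rfl rfl ?_
        rw [Function.update_of_ne hab.symm, hb]
      · funext j; simp; grind

theorem exec_trimTo {a b : K} (hab : a ≠ b) (l : List Bool)
    (S : K → List (Option Bool)) (ha : S a = l.map some) (hb : S b = []) :
    (trimTo a b false).Exec S (3 * l.length + 2) ()
      (Function.update (Function.update S a []) b (natWord (bitsVal l.reverse))) := by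
  have := exec_trimTo_aux hab l 0 S ha (by simp [hb, natWord])
  simpa [bitsVal] using this

theorem exec_readTo {a b : K} (hab : a ≠ b) (l : List Bool) (r : List (Option Bool))
    (S : K → List (Option Bool)) (h : S a = l.map some ++ none :: r) :
    (readTo a b).Exec S (3 * l.length + 2) ()
      (Function.update (Function.update S a r) b (l.reverse.map some ++ S b)) := by
  induction l generalizing S with
  | nil =>
    refine Exec.congr (Exec.iter_exit (Exec.bind (exec_pop_cons h) exec_pure)) (by simp) rfl ?_
    funext j; grind
  | cons s l ih =>
    refine Exec.congr (Exec.iter_next (Exec.bind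
      (exec_pop_cons (l := l.map some ++ none :: r) h)
      (Exec.bind (exec_push b (some s)) exec_pure)) (ih _ ?_)) (by simp; omega) rfl ?_
    · grind
    · funext j; grind

/-- Read a natural number from stack `a` to stack `b`. -/
def readNat (a b u : K) : Frag K (Option Bool) Unit :=
  (readTo a u).bind fun _ => trimTo u b false

/-- The two transfers reverse the digits twice, and trimming returns the canonical word of `m`. -/
theorem exec_readNat {a b u : K} (hab : a ≠ b) (hau : a ≠ u) (hbu : b ≠ u) (m : ℕ)
    (r : List (Option Bool)) (S : K → List (Option Bool)) (ha : S a = encodeNatSep m ++ r)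
    (hb : S b = []) (hu : S u = []) :
    (readNat a b u).Exec S (6 * m.size + 4) ()
      (Function.update (Function.update S a r) b (natWord m)) := by
  refine ((exec_readTo hau m.bits r S (by simp [ha, encodeNatSep])).bind
    (exec_trimTo hbu.symm m.bits.reverse _ (by simp [hu]) ?_)).congr ?_ rfl ?_
  · grind
  · simp only [List.length_reverse, ← Nat.size_eq_bits_len]; omega
  · simp only [List.reverse_reverse, bitsVal_bits]
    funext j; grind

/-- Remove leading zeros from the number on stack `a`. -/
def normalize (a u : K) : Frag K (Option Bool) Unit :=
  (moveTo a u).bind fun _ => trimTo u a false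

theorem exec_normalize {a u : K} (hau : a ≠ u) (l : List Bool) (S : K → List (Option Bool))
    (ha : S a = l.map some) (hu : S u = []) :
    (normalize a u).Exec S (6 * l.length + 4) ()
      (Function.update S a (natWord (bitsVal l))) := by
  refine ((exec_moveTo hau _ S ha).bind
    (exec_trimTo hau.symm l.reverse _ (by simp [hu]) ?_)).congr ?_ rfl ?_
  · grind
  · simp; omega
  · simp only [List.reverse_reverse]
    funext j; grind

end Subroutines

/-! ### Arithmetic on binary numbers -/

/-- The bit that is given by the top of a stack; missing digits are `0`. -/
def topBit (x : Option (Option Bool)) : Bool := (x.getD none).getD false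

/-- Digit and carry of the sum of two bits and a carry. -/
def addBits (c x y : Bool) : Bool × Bool := (xor c (xor x y), (x && y) || (c && (x || y)))

/-- Digit and borrow of the difference of two bits with a borrow. -/
def subBits (c x y : Bool) : Bool × Bool := (xor c (xor x y), (!x && y) || (c && (!x || y)))

section Arithmetic

variable {K : Type}

/-- Run through the digits on the stacks `a` and `b`, writing the digits produced by `δ` to `u` and
copying `b` to `v`; return the final carry. -/
def combine (δ : Bool → Bool → Bool → Bool × Bool) (a b u v : K) (c : Bool) :
    Frag K (Option Bool) Bool :=
  iter (Q := Bool) (fun c => (pop a).bind fun x => (pop b).bind fun y =>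
    if x = none ∧ y = none then pure (.inr c) else
      (push u (some (δ c (topBit x) (topBit y)).1)).bind fun _ =>
      (y.elim (pure ()) (push v)).bind fun _ =>
      pure (.inl (δ c (topBit x) (topBit y)).2)) c

/-- Add the number on stack `b` to the number on stack `a`. -/
def addTo (a b u v : K) : Frag K (Option Bool) Unit :=
  (combine addBits a b u v false).bind fun c =>
  (if c then push u (some true) else pure ()).bind fun _ =>
  (moveTo v b).bind fun _ => trimTo u a false

/-- Subtract the number on stack `b` from the number on stack `a`, truncating at `0`; return whether
the difference is negative. -/
def subFrom (a b u v : K) : Frag K (Option Bool) Bool :=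
  (combine subBits a b u v false).bind fun c =>
  (if c then clear u else pure ()).bind fun _ =>
  (moveTo v b).bind fun _ => (trimTo u a false).bind fun _ => pure c

/-- Multiply the number on stack `a` by the number on stack `b`. -/
def mulBy (a b u v w : K) : Frag K (Option Bool) Unit :=
  (moveTo a w).bind fun _ =>
  iter (Q := Unit) (fun _ => (pop w).bind fun
    | none => pure (.inr ())
    | some s => (push a (some false)).bind fun _ =>
      (if s = some true then addTo a b u v else normalize a u).bind fun _ => pure (.inl ())) ()

variable [DecidableEq K]

theorem topBit_head? (l : List Bool) : topBit (l.head?.map some) = l.headD false := by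
  cases l <;> rfl

theorem exec_pop_map {a : K} {l : List Bool} {S : K → List (Option Bool)}
    (h : S a = l.map some) :
    (pop a).Exec S 1 (l.head?.map some) (Function.update S a (l.tail.map some)) :=
  (exec_pop a).congr le_rfl (by simp [h]) (by simp [h])

/-- One invariant covers addition (`σ = 1`) and subtraction (`σ = -1`): the local identity `hδ` for
a digit and its carry telescopes over all positions, leaving the final carry with weight `2 ^
l.length`. Exhausted stacks are read as zeros. -/
theorem exec_combine {δ : Bool → Bool → Bool → Bool × Bool} (σ : ℤ)
    (hδ : ∀ c x y, ((δ c x y).1.toNat : ℤ) + 2 * σ * (δ c x y).2.toNat =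
      x.toNat + σ * y.toNat + σ * c.toNat)
    {a b u v : K} (hab : a ≠ b) (hau : a ≠ u) (hav : a ≠ v) (hbu : b ≠ u) (hbv : b ≠ v)
    (huv : u ≠ v) (N : ℕ) (xs ys : List Bool) (c : Bool) (S : K → List (Option Bool))
    (ha : S a = xs.map some) (hb : S b = ys.map some) (hx : xs.length ≤ N) (hy : ys.length ≤ N) :
    ∃ (l : List Bool) (c' : Bool), l.length ≤ N ∧
      (bitsVal l : ℤ) + σ * 2 ^ l.length * c'.toNat =
        bitsVal xs + σ * bitsVal ys + σ * c.toNat ∧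
      (combine δ a b u v c).Exec S (6 * N + 3) c'
        (Function.update (Function.update (Function.update (Function.update S a []) b [])
          u (l.reverse.map some ++ S u)) v (ys.reverse.map some ++ S v)) := by
  induction N generalizing xs ys c S with
  | zero =>
    obtain rfl : xs = [] := List.length_eq_zero_iff.1 (by omega)
    obtain rfl : ys = [] := List.length_eq_zero_iff.1 (by omega)
    refine ⟨[], c, le_rfl, by simp, ?_⟩
    refine Exec.congr (Exec.iter_exit (Exec.bind (exec_pop_nil ha) (Exec.bind (exec_pop_nil hb)
      exec_pure))) (by simp) rfl ?_
    funext j; grind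
  | succ N ih =>
    by_cases hnil : xs = [] ∧ ys = []
    · obtain ⟨rfl, rfl⟩ := hnil
      refine ⟨[], c, by simp, by simp, ?_⟩
      refine Exec.congr (Exec.iter_exit (Exec.bind (exec_pop_nil ha) (Exec.bind (exec_pop_nil hb)
        exec_pure))) (by omega) rfl ?_
      funext j; grind
    · set d := δ c (xs.headD false) (ys.headD false) with hd
      obtain ⟨l, c', hl, hval, hex⟩ := ih xs.tail ys.tail d.2
        (Function.update (Function.update (Function.update (Function.update S a
          (xs.tail.map some)) b (ys.tail.map some)) u (some d.1 :: S u)) v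
          ((ys.head?.map some).toList ++ S v)) (by grind) (by grind)
        (by simp; omega) (by simp; omega)
      refine ⟨d.1 :: l, c', by simpa using hl, ?_, ?_⟩
      · have h := hδ c (xs.headD false) (ys.headD false)
        rw [← hd] at h
        rw [bitsVal_cons, Nat.bit_val, List.length_cons, pow_succ, bitsVal_eq_head_tail xs,
          bitsVal_eq_head_tail ys]
        push_cast
        linear_combination 2 * hval + h
      · have step : ((pop a).bind fun x => (pop b).bind fun y =>
            if x = none ∧ y = none then (pure (.inr c) : Frag K (Option Bool) (Bool ⊕ Bool)) else
              (push u (some (δ c (topBit x) (topBit y)).1)).bind fun _ =>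
              (y.elim (pure ()) (push v)).bind fun _ =>
              pure (.inl (δ c (topBit x) (topBit y)).2)).Exec S (1 + (1 + (1 + (1 + 1))))
            (.inl d.2) (Function.update (Function.update (Function.update (Function.update S a
          (xs.tail.map some)) b (ys.tail.map some)) u (some d.1 :: S u)) v
          ((ys.head?.map some).toList ++ S v)) := by
          refine Exec.bind (exec_pop_map ha) (Exec.bind (exec_pop_map (l := ys) ?_) ?_)
          · rwa [Function.update_of_ne hab.symm]
          rw [topBit_head?, topBit_head?, if_neg (by simpa using hnil), ← hd]
          refine Exec.bind (exec_push u _) ?_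
          clear hex hval ih hδ hnil hd hl
          cases ys with
          | nil =>
            refine Exec.bind exec_pure (Exec.congr exec_pure le_rfl rfl ?_)
            funext j; grind
          | cons y ys =>
            refine Exec.bind (exec_push v _) (Exec.congr exec_pure le_rfl rfl ?_)
            funext j; grind
        refine Exec.congr (Exec.iter_next step hex) (by omega) rfl ?_
        clear hex hval ih hδ hnil hd hl step
        funext j
        cases ys <;> grind

/-- The word `xs` may have leading zeros, because multiplication doubles a number by pushing a zero
even when it is `0`. -/
theorem exec_addTo {a b u v : K} (hab : a ≠ b) (hau : a ≠ u) (hav : a ≠ v) (hbu : b ≠ u)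
    (hbv : b ≠ v) (huv : u ≠ v) {N x y : ℕ} (xs : List Bool) {S : K → List (Option Bool)}
    (ha : S a = xs.map some) (hx : xs.length ≤ N) (hxs : bitsVal xs = x)
    (hb : S b = natWord y) (hy : y < 2 ^ N) (hu : S u = []) (hv : S v = []) :
    (addTo a b u v).Exec S (14 * N + 11) () (Function.update S a (natWord (x + y))) := by
  have hyN : y.bits.length ≤ N := by rwa [Nat.size_eq_bits_len, Nat.size_le]
  obtain ⟨l, c, hl, hval, hex⟩ := exec_combine (δ := addBits) 1 (by decide) hab hau hav hbu hbv huv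
    N xs y.bits false S ha hb hx hyN
  rw [bitsVal_bits, hxs] at hval
  set S₁ := Function.update (Function.update (Function.update (Function.update S a []) b [])
    u (l.reverse.map some ++ S u)) v (y.bits.reverse.map some ++ S v) with hS₁
  -- The digits on `u` are reversed, so a push there appends the carry as the most significant
  -- digit.
  have hcarry : (if c then push u (some true) else pure () : Frag K (Option Bool) Unit).Exec S₁ 1 ()
      (Function.update S₁ u ((l ++ if c then [true] else []).reverse.map some)) := by
    cases c
    · refine exec_pure.congr le_rfl rfl ?_
      funext j; grind
    · refine (exec_push u (some true)).congr le_rfl rfl ?_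
      funext j; grind
  refine Exec.congr (hex.bind (hcarry.bind ((exec_moveTo hbv.symm (y.bits.reverse.map some) _
    ?_).bind (exec_trimTo hau.symm (l ++ if c then [true] else []).reverse _ ?_ ?_)))) ?_ rfl ?_
  · grind
  · grind
  · grind
  · cases c <;> simp <;> omega
  · have : bitsVal (l ++ if c then [true] else []) = x + y := by
      rw [bitsVal_append]
      zify
      cases c <;> simp at hval ⊢ <;> linarith
    have hrev : (y.bits.reverse.map (some : Bool → Option Bool)).reverse = S b := by
      rw [hb, natWord]; simp
    rw [List.reverse_reverse, this, hrev]
    clear hex hcarry this hval hrev hxs hx hy hl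
    funext j; grind (gen := 16)

theorem exec_subFrom {a b u v : K} (hab : a ≠ b) (hau : a ≠ u) (hav : a ≠ v) (hbu : b ≠ u)
    (hbv : b ≠ v) (huv : u ≠ v) {N x y : ℕ} {S : K → List (Option Bool)}
    (ha : S a = natWord x) (hx : x < 2 ^ N) (hb : S b = natWord y) (hy : y < 2 ^ N)
    (hu : S u = []) (hv : S v = []) :
    (subFrom a b u v).Exec S (14 * N + 11) (decide (x < y))
      (Function.update S a (natWord (x - y))) := by
  have hxN : x.bits.length ≤ N := by rwa [Nat.size_eq_bits_len, Nat.size_le]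
  have hyN : y.bits.length ≤ N := by rwa [Nat.size_eq_bits_len, Nat.size_le]
  obtain ⟨l, c, hl, hval, hex⟩ := exec_combine (δ := subBits) (-1) (by decide) hab hau hav hbu hbv
    huv N x.bits y.bits false S ha hb hxN hyN
  rw [bitsVal_bits, bitsVal_bits] at hval
  have hlt : (bitsVal l : ℤ) < 2 ^ l.length := by exact_mod_cast bitsVal_lt l
  set S₁ := Function.update (Function.update (Function.update (Function.update S a []) b [])
    u (l.reverse.map some ++ S u)) v (y.bits.reverse.map some ++ S v) with hS₁
  have hcarry : (if c then clear u else pure () : Frag K (Option Bool) Unit).Exec S₁ (2 * N + 2) ()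
      (Function.update S₁ u ((if c then [] else l).reverse.map some)) := by
    cases c
    · refine exec_pure.congr (by omega) rfl ?_
      funext j; grind
    · refine (exec_clear u (l.reverse.map some) S₁ (by grind)).congr (by simpa using hl) rfl ?_
      funext j; grind
  -- The value of the digits lies in `[0, 2 ^ l.length)`, so by `hval` a borrow is left over exactly
  -- when `x - y` is negative.
  have hc : c = decide (x < y) := by
    cases c
    · simp at hval ⊢; omega
    · simp at hval ⊢; omega
  refine Exec.congr (hex.bind (hcarry.bind ((exec_moveTo hbv.symm (y.bits.reverse.map some) _
    ?_).bind ((exec_trimTo hau.symm (if c then [] else l).reverse _ ?_ ?_).bind exec_pure))))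
    ?_ hc ?_
  · grind
  · grind
  · grind
  · cases c <;> simp <;> omega
  · have : bitsVal (if c then [] else l) = x - y := by
      cases c <;> simp at hval ⊢ <;> omega
    have hrev : (y.bits.reverse.map (some : Bool → Option Bool)).reverse = S b := by
      rw [hb, natWord]; simp
    rw [List.reverse_reverse, this, hrev]
    clear hex hcarry this hval hrev hc hlt hx hy hl
    funext j; grind (gen := 16)

/-- Horner's scheme, with the unread digits of the multiplier on `w`, most significant first, and
the partial product `m` on `a`. The expression bounded in `hN` is the final product and does not
change from round to round, so it bounds every intermediate value. -/
theorem exec_mulBy_loop {a b u v w : K} (hab : a ≠ b) (hau : a ≠ u) (hav : a ≠ v) (hbu : b ≠ u)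
    (hbv : b ≠ v) (huv : u ≠ v) (haw : a ≠ w) (hbw : b ≠ w) (huw : u ≠ w) (hvw : v ≠ w)
    {N y : ℕ} (hy : y < 2 ^ N) (l : List Bool) (m : ℕ) (S : K → List (Option Bool))
    (ha : S a = natWord m) (hb : S b = natWord y) (hu : S u = []) (hv : S v = [])
    (hw : S w = l.map some) (hN : m * 2 ^ l.length + bitsVal l.reverse * y < 2 ^ N) :
    (iter (Q := Unit) (fun _ => (pop w).bind fun
      | none => pure (.inr ())
      | some s => (push a (some false)).bind fun _ =>
        (if s = some true then addTo a b u v else normalize a u).bind fun _ => pure (.inl ())) ()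
      : Frag K (Option Bool) Unit).Exec S (l.length * (14 * N + 28) + 2) ()
        (Function.update (Function.update S w []) a
          (natWord (m * 2 ^ l.length + bitsVal l.reverse * y))) := by
  induction l generalizing m S with
  | nil =>
    refine Exec.congr (Exec.iter_exit (Exec.bind (exec_pop_nil hw) exec_pure)) (by simp) rfl ?_
    simp only [List.length_nil, pow_zero, mul_one, List.reverse_nil, bitsVal_nil, zero_mul,
      add_zero]
    funext j; grind
  | cons s l ih =>
    have hval : m * 2 ^ (s :: l).length + bitsVal (s :: l).reverse * y =
        (2 * m + s.toNat * y) * 2 ^ l.length + bitsVal l.reverse * y := by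
      rw [List.reverse_cons, bitsVal_append, List.length_reverse, List.length_cons, pow_succ,
        bitsVal_cons, bitsVal_nil, Nat.bit_val]
      ring
    rw [hval] at hN ⊢
    have hmN : m < 2 ^ N := by
      have : 2 * m + s.toNat * y ≤ (2 * m + s.toNat * y) * 2 ^ l.length :=
        Nat.le_mul_of_pos_right _ (by positivity)
      omega
    obtain ⟨xs, hxs, hxm⟩ : ∃ xs : List Bool, natWord m = xs.map some ∧ bitsVal xs = m :=
      natWord_eq m
    have hlen : xs.length ≤ N := by
      have := length_natWord_le.2 hmN
      simpa [hxs] using this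
    set S₁ := Function.update (Function.update S w (l.map some)) a (some false :: S a) with hS₁
    have hS₁a : S₁ a = (false :: xs).map some := by grind
    have hbv' : bitsVal (false :: xs) = 2 * m := by simp [Nat.bit_val, hxm]
    have hbody : (if some s = some true then addTo a b u v else normalize a u).Exec S₁
        (14 * N + 25) () (Function.update S₁ a (natWord (2 * m + s.toNat * y))) := by
      cases s
      · refine (exec_normalize hau (false :: xs) S₁ hS₁a (by grind)).congr ?_ rfl ?_
        · simp; omega
        · simp [hxm, Nat.bit_val]
      -- The doubled word has one digit more than `m`, hence the bound `N + 1`.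
      · refine (exec_addTo hab hau hav hbu hbv huv (N := N + 1) (false :: xs) hS₁a (by simpa)
          hbv' (y := y) ?_ ?_ ?_ ?_).congr ?_ rfl ?_
        · grind
        · rw [pow_succ]; omega
        · grind
        · grind
        · omega
        · simp
    refine Exec.congr (Exec.iter_next
      (Exec.bind (exec_pop_cons (l := l.map some) (by simpa using hw))
      (Exec.bind (exec_push a (some false)) (Exec.bind (t := 14 * N + 25) (e := ())
        (S' := Function.update S₁ a (natWord (2 * m + s.toNat * y))) ?_ exec_pure)))
      (ih (2 * m + s.toNat * y) _ ?_ ?_ ?_ ?_ ?_ hN)) ?_ rfl ?_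
    · rwa [Function.update_of_ne haw]
    · grind
    · grind
    · grind
    · grind
    · grind
    · simp only [List.length_cons]; ring_nf; omega
    · funext j; grind

theorem exec_mulBy {a b u v w : K} (hab : a ≠ b) (hau : a ≠ u) (hav : a ≠ v) (hbu : b ≠ u)
    (hbv : b ≠ v) (huv : u ≠ v) (haw : a ≠ w) (hbw : b ≠ w) (huw : u ≠ w) (hvw : v ≠ w)
    {N x y : ℕ} {S : K → List (Option Bool)} (ha : S a = natWord x) (hx : x < 2 ^ N)
    (hb : S b = natWord y) (hy : y < 2 ^ N) (hu : S u = []) (hv : S v = []) (hw : S w = []) :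
    (mulBy a b u v w).Exec S (32 * (N + 1) ^ 2) () (Function.update S a (natWord (x * y))) := by
  have hxN : x.bits.length ≤ N := by rwa [Nat.size_eq_bits_len, Nat.size_le]
  have hxy : x * y < 2 ^ (2 * N) := by
    rw [two_mul, pow_add]
    exact Nat.mul_lt_mul'' hx hy
  refine Exec.congr (Exec.bind (exec_moveTo haw _ S ha) (exec_mulBy_loop hab hau hav hbu hbv huv
    haw hbw huw hvw (N := 2 * N) (hy.trans_le (Nat.pow_le_pow_right (by norm_num) (by omega)))
    x.bits.reverse 0 _ ?_ ?_ ?_ ?_ ?_ ?_)) ?_ rfl ?_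
  · rw [Function.update_of_ne haw, Function.update_self]; simp [natWord]
  · grind
  · grind
  · grind
  · simp [hw, natWord]
  · simpa [bitsVal_bits] using hxy
  · rw [Nat.size_eq_bits_len] at hxN
    rw [length_natWord, List.length_reverse, Nat.size_eq_bits_len]
    nlinarith [Nat.mul_le_mul_right (28 * N + 31) hxN]
  · simp only [zero_mul, zero_add, List.reverse_reverse, bitsVal_bits]
    funext j; grind

end Arithmetic

/-! ### Polynomial-time computability from fragments -/

section Machines

variable {K Γ E α β : Type} [DecidableEq K] [Fintype K] [Fintype Γ] [Finite E]

theorem initList_toMachine {O : Type} (F : Frag K Γ E) (out : E → Option O) (k₀ : K)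
    (k₁ : Option K) (l : List Γ) :
    initList (F.toMachine out k₀ k₁) l =
      ⟨some (.inl F.entry), none, extend [] (Function.update (fun _ => []) k₀ l)⟩ := by
  unfold initList
  congr 1
  funext k
  by_cases h : k = some k₀
  · subst h
    refine (dif_pos rfl).trans ?_
    change l = Function.update (fun _ => []) k₀ l k₀
    rw [Function.update_self]
  · refine (dif_neg h).trans ?_
    cases k with
    | none => rfl
    | some k =>
      change [] = Function.update (fun _ => []) k₀ l k
      rw [Function.update_of_ne fun e => h (congrArg some e)]

/-- The output is left on an ordinary stack, with all others empty; the additional stack is never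
used and its alphabet is arbitrary. -/
theorem computableInPolyTime_of_exec {enc : α → List Γ} {encβ : β → List Γ} {f : α → β}
    (F : Frag K Γ E) (k₀ k₁ : K) (p : Polynomial ℕ)
    (h : ∀ a, ∃ e, F.Exec (Function.update (fun _ => []) k₀ (enc a)) (p.eval (enc a).length) e
      (Function.update (fun _ => []) k₁ (encβ (f a)))) :
    Nonempty (TM2ComputableInPolyTime enc encβ f) := by
  have key : ∀ a, ∃ n ≤ p.eval (enc a).length + 1,
      (flip Option.bind (F.toMachine (fun _ => (none : Option Bool)) k₀ (some k₁)).step)^[n]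
        (some (initList (F.toMachine (fun _ => (none : Option Bool)) k₀ (some k₁)) (enc a))) =
      some (haltList (F.toMachine (fun _ => (none : Option Bool)) k₀ (some k₁)) (encβ (f a))) := by
    intro a
    obtain ⟨e, he⟩ := h a
    obtain ⟨n, hn, hs⟩ := he.toMachine (fun _ => (none : Option Bool)) k₀ (some k₁)
    refine ⟨n, hn, ?_⟩
    rw [initList_toMachine]
    refine hs.trans (congrArg some ?_)
    unfold haltList
    congr 1
    funext k
    by_cases h : k = some k₁
    · subst h
      refine Eq.trans ?_ (dif_pos rfl).symm
      change Function.update (fun _ => []) k₁ (encβ (f a)) k₁ = encβ (f a)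
      rw [Function.update_self]
    · refine Eq.trans ?_ (dif_neg h).symm
      cases k with
      | none => rfl
      | some k =>
        change Function.update (fun _ => []) k₁ (encβ (f a)) k = []
        rw [Function.update_of_ne fun e => h (congrArg some e)]
  choose n hn hs using key
  exact ⟨{
    tm := F.toMachine (fun _ => (none : Option Bool)) k₀ (some k₁)
    inputAlphabet := Equiv.refl Γ
    outputAlphabet := Equiv.refl Γ
    time := p + 1
    outputsFun := fun a =>
      { steps := n a
        evals_in_steps := by
          have e₁ : (enc a).map (Equiv.refl Γ).invFun = enc a := List.map_id _
          have e₂ : (encβ (f a)).map (Equiv.refl Γ).invFun = encβ (f a) := List.map_id _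
          exact e₁.symm ▸ e₂.symm ▸ hs a
        steps_le_m := by simpa using hn a } }⟩

/-- Here the answer is the exit itself. It is written to the additional stack, whose alphabet `Bool`
is the one required by `encodeBool`. -/
theorem decidableInPolyTime_of_exec {enc : α → List Γ} {f : α → Bool}
    (F : Frag K Γ Bool) (k₀ : K) (p : Polynomial ℕ)
    (h : ∀ a, F.Exec (Function.update (fun _ => []) k₀ (enc a)) (p.eval (enc a).length) (f a)
      (fun _ => [])) :
    Nonempty (TM2ComputableInPolyTime enc Computability.encodeBool f) := by
  have key : ∀ a, ∃ n ≤ p.eval (enc a).length + 1,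
      (flip Option.bind (F.toMachine some k₀ none).step)^[n]
        (some (initList (F.toMachine some k₀ none) (enc a))) =
      some (haltList (F.toMachine some k₀ none) [f a]) := by
    intro a
    obtain ⟨n, hn, hs⟩ := (h a).toMachine some k₀ none
    refine ⟨n, hn, ?_⟩
    rw [initList_toMachine]
    refine hs.trans (congrArg some ?_)
    unfold haltList
    congr 1
    funext k
    cases k with
    | none => exact Eq.trans (by rfl) (dif_pos rfl).symm
    | some k => exact Eq.trans (by rfl) (dif_neg (Option.some_ne_none k)).symm
  choose n hn hs using key
  exact ⟨{
    tm := F.toMachine some k₀ none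
    inputAlphabet := Equiv.refl Γ
    outputAlphabet := Equiv.refl Bool
    time := p + 1
    outputsFun := fun a =>
      { steps := n a
        evals_in_steps := by
          have e₁ : (enc a).map (Equiv.refl Γ).invFun = enc a := List.map_id _
          exact e₁.symm ▸ hs a
        steps_le_m := by simpa using hn a } }⟩

end Machines

end Frag

/-! ### The regret as a fraction -/

/-- A coordinate of an instance: the bit of the solution, the midpoint and the deviation. -/
abbrev Item := Bool × Frac × Frac

/-- The encoding of a coordinate. -/
def encodeItem (i : Item) : List (Option Bool) :=
  some i.1 :: (encodeFrac i.2.1 ++ encodeFrac i.2.2)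

/-- The numerator of the contribution of one coordinate. -/
def itemNum (i : Item) : ℕ :=
  if i.1 ≠ decide (i.2.1.num < 0) then
    i.2.2.num.natAbs * i.2.1.den + i.2.1.num.natAbs * i.2.2.den
  else i.2.2.num.natAbs * i.2.1.den - i.2.1.num.natAbs * i.2.2.den

/-- The denominator of the contribution of one coordinate. -/
def itemDen (i : Item) : ℕ := i.2.1.den * i.2.2.den

/-- Add the contribution of a coordinate to a fraction. -/
def addItem (s : ℕ × ℕ) (i : Item) : ℕ × ℕ :=
  (s.1 * itemDen i + itemNum i * s.2, s.2 * itemDen i)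

theorem itemDen_pos (i : Item) : 0 < itemDen i := Nat.mul_pos i.2.1.den_pos i.2.2.den_pos

theorem cast_tsub_eq_max (r p : ℕ) : ((r - p : ℕ) : ℝ) = max 0 ((r : ℝ) - p) := by
  rcases le_total p r with h | h
  · rw [Nat.cast_sub h, max_eq_right (sub_nonneg.2 (by exact_mod_cast h))]
  · rw [Nat.sub_eq_zero_of_le h, max_eq_left (sub_nonpos.2 (by exact_mod_cast h)), Nat.cast_zero]

/-- In `d + (2 * x - 1) * chat` the absolute value of `chat` is added if the bit `x` differs from
the sign bit of `chat` and subtracted otherwise. The maximum with `0` matters only in the second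
case, where truncated subtraction of naturals provides it. -/
theorem itemNum_div_itemDen (i : Item) (h : 0 ≤ i.2.2.num) :
    (itemNum i : ℝ) / itemDen i =
      regretTerm i.2.1.val i.2.2.val (if i.1 then 1 else 0) := by
  obtain ⟨x, ⟨cn, cd, hc⟩, ⟨dn, dd, hd⟩⟩ := i
  simp only at h
  lift dn to ℕ using h
  have hc' : (0 : ℝ) < cd := by exact_mod_cast hc
  have hd' : (0 : ℝ) < dd := by exact_mod_cast hd
  have hadd : ∀ r : ℕ, ((dn : ℝ) * cd + r * dd) / (cd * dd) =
      max 0 ((dn : ℝ) / dd + (r : ℝ) / cd) := by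
    intro r
    rw [max_eq_right (by positivity)]
    field_simp
  have hsub : ∀ r : ℕ, max 0 ((dn : ℝ) * cd - r * dd) / (cd * dd) =
      max 0 ((dn : ℝ) / dd - (r : ℝ) / cd) := by
    intro r
    rw [← max_div_div_right (by positivity), zero_div]
    congr 1
    field_simp
  have hcn : (cn : ℝ) = if cn < 0 then -(cn.natAbs : ℝ) else cn.natAbs := by
    split_ifs with h <;> rw [Nat.cast_natAbs]
    · rw [abs_of_neg h]; simp
    · rw [abs_of_nonneg (not_lt.1 h)]
  unfold itemNum itemDen regretTerm Frac.val
  simp only [hcn, Int.natAbs_natCast, Int.cast_natCast]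
  by_cases hneg : cn < 0 <;> cases x <;>
    simp only [hneg, if_true, if_false, decide_true, decide_false, ne_eq, not_true_eq_false,
      reduceCtorEq, not_false_eq_true, Bool.false_eq_true, Nat.cast_add, Nat.cast_mul,
      cast_tsub_eq_max, hadd, hsub] <;>
    congr 1 <;> ring

theorem foldl_addItem_pos (l : List Item) (s : ℕ × ℕ) (hs : 0 < s.2) :
    0 < (l.foldl addItem s).2 := by
  induction l generalizing s with
  | nil => exact hs
  | cons i l ih => exact ih _ (Nat.mul_pos hs (itemDen_pos i))

theorem foldl_addItem_div (l : List Item) (s : ℕ × ℕ) (hs : 0 < s.2) :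
    ((l.foldl addItem s).1 : ℝ) / (l.foldl addItem s).2 =
      s.1 / s.2 + (l.map fun i => (itemNum i : ℝ) / itemDen i).sum := by
  induction l generalizing s with
  | nil => simp
  | cons i l ih =>
    have h₁ : (s.2 : ℝ) ≠ 0 := by exact_mod_cast hs.ne'
    have h₂ : (itemDen i : ℝ) ≠ 0 := by exact_mod_cast (itemDen_pos i).ne'
    rw [List.foldl_cons, ih _ (Nat.mul_pos hs (itemDen_pos i)), List.map_cons, List.sum_cons,
      ← add_assoc]
    congr 1
    simp only [addItem]
    push_cast
    field_simp

/-- The coordinates of an instance. -/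
def EvalInstance.items (I : EvalInstance) : List Item :=
  (List.finRange I.n).map fun i => (I.x i, I.chat i, I.d i)

theorem encodeInstance_eq (I : EvalInstance) : encodeInstance I = I.items.flatMap encodeItem := by
  rw [EvalInstance.items, List.flatMap_map]; rfl

/-- The regret of an instance as a fraction. -/
def EvalInstance.regretFrac (I : EvalInstance) : Frac where
  num := (I.items.foldl addItem (0, 1)).1
  den := (I.items.foldl addItem (0, 1)).2
  den_pos := foldl_addItem_pos _ _ one_pos

theorem EvalInstance.regretFrac_val (I : EvalInstance) : I.regretFrac.val = I.regret := by
  rw [EvalInstance.regret, regret_eq_sum, Frac.val, regretFrac]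
  · simp only [Int.cast_natCast]
    rw [foldl_addItem_div _ _ one_pos, EvalInstance.items, List.map_map, Fin.sum_univ_def]
    simp only [Nat.cast_zero, zero_div, zero_add]
    congr 1
    exact List.map_congr_left fun i _ => itemNum_div_itemDen _ (I.d_nonneg i)
  · exact fun i => div_nonneg (by exact_mod_cast I.d_nonneg i) (Nat.cast_nonneg _)
  · intro i
    cases h : I.x i <;> simp [h]

/-! ### Size bounds for the intermediate numbers -/

theorem length_encodeFrac (q : Frac) :
    (encodeFrac q).length = q.num.natAbs.size + q.den.size + 3 := by
  simp [encodeFrac, encodeNatSep, Nat.size_eq_bits_len]; omega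

/-- All numbers that occur in the addition of a coordinate to the fraction `s` have at most `N`
binary digits. -/
structure ItemBounds (N : ℕ) (s : ℕ × ℕ) (i : Item) : Prop where
  cnum : i.2.1.num.natAbs < 2 ^ N
  cden : i.2.1.den < 2 ^ N
  dnum : i.2.2.num.natAbs < 2 ^ N
  dden : i.2.2.den < 2 ^ N
  left : i.2.1.num.natAbs * i.2.2.den < 2 ^ N
  right : i.2.2.num.natAbs * i.2.1.den < 2 ^ N
  den : itemDen i < 2 ^ N
  num : itemNum i < 2 ^ N
  accNum : s.1 < 2 ^ N
  accDen : s.2 < 2 ^ N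
  scaled : s.1 * itemDen i < 2 ^ N
  term : itemNum i * s.2 < 2 ^ N
  newNum : (addItem s i).1 < 2 ^ N
  newDen : (addItem s i).2 < 2 ^ N

/-- A product has at most as many digits as its factors together, so absorbing a coordinate
lengthens the accumulated fraction by at most the length of its encoding. The 7 symbols other than
digits (the bit, two signs, four separators) absorb the carries of the additions. -/
theorem itemBounds {m : ℕ} {s : ℕ × ℕ} (h₁ : s.1 < 2 ^ m) (h₂ : s.2 < 2 ^ m) (i : Item) :
    ItemBounds (m + (encodeItem i).length) s i := by
  obtain ⟨x, ⟨cn, cd, hc⟩, ⟨dn, dd, hd⟩⟩ := i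
  set k := cn.natAbs.size + cd.size + dn.natAbs.size + dd.size with hk
  have hlen : (encodeItem (x, ⟨cn, cd, hc⟩, ⟨dn, dd, hd⟩)).length = k + 7 := by
    simp only [encodeItem, List.length_cons, List.length_append, length_encodeFrac]; omega
  rw [hlen]
  have mono : ∀ {y e : ℕ}, y < 2 ^ e → e ≤ m + (k + 7) → y < 2 ^ (m + (k + 7)) :=
    fun h h' => h.trans_le (Nat.pow_le_pow_right (by norm_num) h')
  have mul : ∀ {y z e f : ℕ}, y < 2 ^ e → z < 2 ^ f → y * z < 2 ^ (e + f) := by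
    intro y z e f h h'
    rw [pow_add]
    exact Nat.mul_lt_mul'' h h'
  have c1 := Nat.lt_size_self cn.natAbs
  have c2 := Nat.lt_size_self cd
  have c3 := Nat.lt_size_self dn.natAbs
  have c4 := Nat.lt_size_self dd
  have left := mul c1 c4
  have right := mul c3 c2
  have den := mul c2 c4
  have leftk : cn.natAbs * dd < 2 ^ k :=
    left.trans_le (Nat.pow_le_pow_right (by norm_num) (by omega))
  have rightk : dn.natAbs * cd < 2 ^ k :=
    right.trans_le (Nat.pow_le_pow_right (by norm_num) (by omega))
  have denk : cd * dd < 2 ^ k := den.trans_le (Nat.pow_le_pow_right (by norm_num) (by omega))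
  have num : itemNum (x, ⟨cn, cd, hc⟩, ⟨dn, dd, hd⟩) < 2 ^ (k + 1) := by
    rw [itemNum, pow_succ]
    split_ifs <;> simp only <;> omega
  have scaled := mul h₁ denk
  have term := mul num h₂
  refine ⟨mono c1 (by omega), mono c2 (by omega), mono c3 (by omega), mono c4 (by omega),
    mono leftk (by omega), mono rightk (by omega), mono denk (by omega), mono num (by omega),
    mono h₁ (by omega), mono h₂ (by omega), mono scaled (by omega), mono term (by omega),
    -- The new numerator is a sum of a number below `2 ^ (m + k)` and one below `2 ^ (m + k + 1)`.
    mono (e := m + k + 2) ?_ (by omega), mono (mul h₂ denk) (by omega)⟩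
  simp only [addItem]
  rw [pow_add]
  have e : (2 : ℕ) ^ (k + 1 + m) = 2 * 2 ^ (m + k) := by ring
  rw [e] at term
  simp only [itemDen] at scaled ⊢
  omega

open Frag

theorem ItemBounds.mono {M N : ℕ} {s : ℕ × ℕ} {i : Item} (h : ItemBounds M s i) (hMN : M ≤ N) :
    ItemBounds N s i := by
  have key : ∀ {y : ℕ}, y < 2 ^ M → y < 2 ^ N :=
    fun hy => hy.trans_le (Nat.pow_le_pow_right (by norm_num) hMN)
  obtain ⟨h1, h2, h3, h4, h5, h6, h7, h8, h9, h10, h11, h12, h13, h14⟩ := h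
  exact ⟨key h1, key h2, key h3, key h4, key h5, key h6, key h7, key h8, key h9, key h10, key h11,
    key h12, key h13, key h14⟩

/-! ### The programs for the evaluation problem and its decision version -/

/-- The stacks: the input, the accumulated fraction `A / B`, the data `P / Q` and `R / Z` of a
coordinate, the threshold `M / D`, and three auxiliary stacks. -/
inductive Reg | inp | A | B | P | Q | R | Z | M | D | u | v | w
  deriving DecidableEq

instance : Fintype Reg :=
  ⟨{.inp, .A, .B, .P, .Q, .R, .Z, .M, .D, .u, .v, .w}, by rintro ⟨⟩ <;> decide⟩

theorem natWord_zero : natWord 0 = [] := by simp [natWord]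

/-- Stack contents with the given numbers and with empty auxiliary stacks. -/
def store (i : List (Option Bool)) (a b p q r z m d : ℕ) : Reg → List (Option Bool)
  | .inp => i
  | .A => natWord a
  | .B => natWord b
  | .P => natWord p
  | .Q => natWord q
  | .R => natWord r
  | .Z => natWord z
  | .M => natWord m
  | .D => natWord d
  | _ => []

section Updates

variable (i i' : List (Option Bool)) (a b p q r z m d y : ℕ)

/-- These identities bring the stacks back to the form `store` after each operation, so that
unification can determine the next state in a long chain of `Exec.bind`. -/
theorem update_inp : Function.update (store i a b p q r z m d) .inp i' =
    store i' a b p q r z m d := by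
  funext k; cases k <;> rfl

theorem update_A : Function.update (store i a b p q r z m d) .A (natWord y) =
    store i y b p q r z m d := by
  funext k; cases k <;> rfl

theorem update_B : Function.update (store i a b p q r z m d) .B (natWord y) =
    store i a y p q r z m d := by
  funext k; cases k <;> rfl

theorem update_P : Function.update (store i a b p q r z m d) .P (natWord y) =
    store i a b y q r z m d := by
  funext k; cases k <;> rfl

theorem update_Q : Function.update (store i a b p q r z m d) .Q (natWord y) =
    store i a b p y r z m d := by
  funext k; cases k <;> rfl

theorem update_R : Function.update (store i a b p q r z m d) .R (natWord y) =
    store i a b p q y z m d := by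
  funext k; cases k <;> rfl

theorem update_Z : Function.update (store i a b p q r z m d) .Z (natWord y) =
    store i a b p q r y m d := by
  funext k; cases k <;> rfl

theorem update_M : Function.update (store i a b p q r z m d) .M (natWord y) =
    store i a b p q r z y d := by
  funext k; cases k <;> rfl

theorem update_D : Function.update (store i a b p q r z m d) .D (natWord y) =
    store i a b p q r z m y := by
  funext k; cases k <;> rfl

theorem update_inp_P : Function.update (Function.update (store i a b p q r z m d) .inp i') .P
    (natWord y) = store i' a b y q r z m d := by
  rw [update_inp, update_P]

theorem update_inp_Q : Function.update (Function.update (store i a b p q r z m d) .inp i') .Q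
    (natWord y) = store i' a b p y r z m d := by
  rw [update_inp, update_Q]

theorem update_inp_R : Function.update (Function.update (store i a b p q r z m d) .inp i') .R
    (natWord y) = store i' a b p q y z m d := by
  rw [update_inp, update_R]

theorem update_inp_Z : Function.update (Function.update (store i a b p q r z m d) .inp i') .Z
    (natWord y) = store i' a b p q r y m d := by
  rw [update_inp, update_Z]

theorem update_inp_M : Function.update (Function.update (store i a b p q r z m d) .inp i') .M
    (natWord y) = store i' a b p q r z y d := by
  rw [update_inp, update_M]

theorem update_inp_D : Function.update (Function.update (store i a b p q r z m d) .inp i') .D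
    (natWord y) = store i' a b p q r z m y := by
  rw [update_inp, update_D]

end Updates

theorem exec_pop_inp {s : Option Bool} {i : List (Option Bool)} {a b p q r z m d : ℕ} :
    (pop .inp).Exec (store (s :: i) a b p q r z m d) 1 (some s) (store i a b p q r z m d) :=
  (exec_pop_cons (S := store (s :: i) a b p q r z m d) rfl).congr le_rfl rfl (update_inp ..)

/-- A bound for the running time of all subroutines on numbers with at most `N` digits. -/
def opTime (N : ℕ) : ℕ := 32 * (N + 1) ^ 2

theorem linear_le_opTime (N : ℕ) : 14 * N + 11 ≤ opTime N := by
  unfold opTime; nlinarith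

section Ops

variable {N x y : ℕ} {a b : Reg} {S S' : Reg → List (Option Bool)}

theorem exec_mul_reg (hab : a ≠ b) (hau : a ≠ .u) (hav : a ≠ .v) (haw : a ≠ .w) (hbu : b ≠ .u)
    (hbv : b ≠ .v) (hbw : b ≠ .w) (ha : S a = natWord x) (hx : x < 2 ^ N) (hb : S b = natWord y)
    (hy : y < 2 ^ N) (hu : S .u = []) (hv : S .v = []) (hw : S .w = [])
    (hS : Function.update S a (natWord (x * y)) = S') :
    (mulBy a b .u .v .w).Exec S (opTime N) () S' :=
  hS ▸ exec_mulBy hab hau hav hbu hbv (by decide) haw hbw (by decide) (by decide) ha hx hb hy hu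
    hv hw

theorem exec_add_reg (hab : a ≠ b) (hau : a ≠ .u) (hav : a ≠ .v) (hbu : b ≠ .u) (hbv : b ≠ .v)
    (ha : S a = natWord x) (hx : x < 2 ^ N) (hb : S b = natWord y) (hy : y < 2 ^ N)
    (hu : S .u = []) (hv : S .v = []) (hS : Function.update S a (natWord (x + y)) = S') :
    (addTo a b .u .v).Exec S (opTime N) () S' :=
  (exec_addTo hab hau hav hbu hbv (by decide) x.bits ha
    (by rwa [Nat.size_eq_bits_len, Nat.size_le]) (bitsVal_bits x) hb hy hu hv).congr
      (linear_le_opTime N) rfl hS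

theorem exec_sub_reg (hab : a ≠ b) (hau : a ≠ .u) (hav : a ≠ .v) (hbu : b ≠ .u) (hbv : b ≠ .v)
    (ha : S a = natWord x) (hx : x < 2 ^ N) (hb : S b = natWord y) (hy : y < 2 ^ N)
    (hu : S .u = []) (hv : S .v = []) (hS : Function.update S a (natWord (x - y)) = S') :
    (subFrom a b .u .v).Exec S (opTime N) (decide (x < y)) S' :=
  (exec_subFrom hab hau hav hbu hbv (by decide) ha hx hb hy hu hv).congr
      (linear_le_opTime N) rfl hS

theorem exec_clear_reg (ha : S a = natWord x) (hx : x < 2 ^ N)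
    (hS : Function.update S a (natWord 0) = S') : (clear a).Exec S (opTime N) () S' :=
  (exec_clear a _ S ha).congr
    ((by have := length_natWord_le.2 hx; omega : _ ≤ 14 * N + 11).trans (linear_le_opTime N)) rfl
    (natWord_zero ▸ hS)

theorem exec_readNat_reg {r : List (Option Bool)} (hai : a ≠ .inp) (hau : a ≠ .u)
    (hi : S .inp = encodeNatSep x ++ r) (hx : x < 2 ^ N) (ha : S a = natWord 0) (hu : S .u = [])
    (hS : Function.update (Function.update S .inp r) a (natWord x) = S') :
    (readNat .inp a .u).Exec S (opTime N) () S' :=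
  (exec_readNat hai.symm (by decide) hau x r S hi (ha.trans natWord_zero) hu).congr
    ((by have := Nat.size_le.2 hx; omega : _ ≤ 14 * N + 11).trans (linear_le_opTime N)) rfl hS

end Ops

/-- Read a coordinate, except for its bit `x`, and add its contribution to `A / B`. -/
def processItem (x : Bool) : Frag Reg (Option Bool) Unit :=
  (pop .inp).bind fun s =>
  (readNat .inp .P .u).bind fun _ =>
  (readNat .inp .Q .u).bind fun _ =>
  (pop .inp).bind fun _ =>
  (readNat .inp .R .u).bind fun _ =>
  (readNat .inp .Z .u).bind fun _ =>
  (mulBy .P .Z .u .v .w).bind fun _ =>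
  (mulBy .R .Q .u .v .w).bind fun _ =>
  (mulBy .Q .Z .u .v .w).bind fun _ =>
  (if x ≠ topBit s then addTo .R .P .u .v else (subFrom .R .P .u .v).bind fun _ => pure ()).bind
    fun _ =>
  (mulBy .A .Q .u .v .w).bind fun _ =>
  (mulBy .R .B .u .v .w).bind fun _ =>
  (addTo .A .R .u .v).bind fun _ =>
  (mulBy .B .Q .u .v .w).bind fun _ =>
  (clear .P).bind fun _ => (clear .Q).bind fun _ => (clear .R).bind fun _ => clear .Z

/-- With `P / Q` the absolute value of the midpoint and `R / Z` that of the deviation, `P` and `R`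
are brought to the common denominator `Q * Z`, which then replaces `Q`. `B` is updated last because
the new numerator needs its old value. -/
theorem exec_processItem {N : ℕ} {s : ℕ × ℕ} {i : Item} (h : ItemBounds N s i)
    (l : List (Option Bool)) (m d : ℕ) :
    (processItem i.1).Exec
      (store (encodeFrac i.2.1 ++ encodeFrac i.2.2 ++ l) s.1 s.2 0 0 0 0 m d) (18 * opTime N) ()
      (store l (addItem s i).1 (addItem s i).2 0 0 0 0 m d) := by
  obtain ⟨x, ⟨cn, cd, hc⟩, ⟨dn, dd, hd⟩⟩ := i
  obtain ⟨a, b⟩ := s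
  obtain ⟨h1, h2, h3, h4, h5, h6, h7, h8, h9, h10, h11, h12, h13, h14⟩ := h
  simp only at h1 h2 h3 h4 h5 h6 h7 h8 h9 h10 h11 h12
  have hT : 4 ≤ opTime N := by have := linear_le_opTime N; omega
  have hcomb : (if x ≠ decide (cn < 0) then addTo .R .P .u .v else
      (subFrom .R .P .u .v).bind fun _ => pure () : Frag Reg (Option Bool) Unit).Exec
      (store l a b (cn.natAbs * dd) (cd * dd) (dn.natAbs * cd) dd m d) (opTime N + 1) ()
      (store l a b (cn.natAbs * dd) (cd * dd)
        (itemNum (x, ⟨cn, cd, hc⟩, ⟨dn, dd, hd⟩)) dd m d) := by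
    unfold itemNum
    simp only
    split_ifs
    · exact (exec_add_reg (by decide) (by decide) (by decide) (by decide) (by decide) rfl h6 rfl h5
        rfl rfl (update_R ..)).mono (by omega)
    · exact (exec_sub_reg (by decide) (by decide) (by decide) (by decide) (by decide) rfl h6 rfl h5
        rfl rfl (update_R ..)).bind exec_pure
  have hnew : addItem (a, b) (x, ⟨cn, cd, hc⟩, ⟨dn, dd, hd⟩) =
      (a * (cd * dd) + itemNum (x, ⟨cn, cd, hc⟩, ⟨dn, dd, hd⟩) * b, b * (cd * dd)) := rfl
  rw [hnew]
  generalize itemNum (x, ⟨cn, cd, hc⟩, ⟨dn, dd, hd⟩) = t at *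
  have hinp : encodeFrac ⟨cn, cd, hc⟩ ++ encodeFrac ⟨dn, dd, hd⟩ ++ l =
      some (decide (cn < 0)) :: (encodeNatSep cn.natAbs ++ (encodeNatSep cd ++
        (some (decide (dn < 0)) :: (encodeNatSep dn.natAbs ++ (encodeNatSep dd ++ l))))) := by
    simp [encodeFrac]
  simp only [hinp]
  refine Exec.mono (Exec.bind exec_pop_inp
    (Exec.bind (exec_readNat_reg (by decide) (by decide) rfl h1 rfl rfl (update_inp_P ..))
    (Exec.bind (exec_readNat_reg (by decide) (by decide) rfl h2 rfl rfl (update_inp_Q ..))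
    (Exec.bind exec_pop_inp
    (Exec.bind (exec_readNat_reg (by decide) (by decide) rfl h3 rfl rfl (update_inp_R ..))
    (Exec.bind (exec_readNat_reg (by decide) (by decide) rfl h4 rfl rfl (update_inp_Z ..))
    (Exec.bind (exec_mul_reg (by decide) (by decide) (by decide) (by decide) (by decide)
      (by decide) (by decide) rfl h1 rfl h4 rfl rfl rfl (update_P ..))
    (Exec.bind (exec_mul_reg (by decide) (by decide) (by decide) (by decide) (by decide)
      (by decide) (by decide) rfl h3 rfl h2 rfl rfl rfl (update_R ..))
    (Exec.bind (exec_mul_reg (by decide) (by decide) (by decide) (by decide) (by decide)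
      (by decide) (by decide) rfl h2 rfl h4 rfl rfl rfl (update_Q ..))
    (Exec.bind hcomb
    (Exec.bind (exec_mul_reg (by decide) (by decide) (by decide) (by decide) (by decide)
      (by decide) (by decide) rfl h9 rfl h7 rfl rfl rfl (update_A ..))
    (Exec.bind (exec_mul_reg (by decide) (by decide) (by decide) (by decide) (by decide)
      (by decide) (by decide) rfl h8 rfl h10 rfl rfl rfl (update_R ..))
    (Exec.bind (exec_add_reg (by decide) (by decide) (by decide) (by decide) (by decide)
      rfl h11 rfl h12 rfl rfl (update_A ..))
    (Exec.bind (exec_mul_reg (by decide) (by decide) (by decide) (by decide) (by decide)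
      (by decide) (by decide) rfl h10 rfl h7 rfl rfl rfl (update_B ..))
    (Exec.bind (exec_clear_reg rfl h5 (update_P ..))
    (Exec.bind (exec_clear_reg rfl h7 (update_Q ..))
    (Exec.bind (exec_clear_reg rfl h12 (update_R ..))
      (exec_clear_reg rfl h4 (update_Z ..))))))))))))))))))) ?_
  omega

/-- Add up the contributions of all coordinates. -/
def accumulate : Frag Reg (Option Bool) Unit :=
  iter (Q := Unit) (fun _ => (pop .inp).bind fun
    | some (some x) => (processItem x).bind fun _ => pure (.inl ())
    | _ => pure (.inr ())) ()

/-- The exponent `e` grows by the length of each coordinate read while the remaining input shrinks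
by the same amount, so a single `N` bounds all rounds. -/
theorem exec_accumulate {N : ℕ} (l : List Item) (s : ℕ × ℕ) (e m d : ℕ) (h₁ : s.1 < 2 ^ e)
    (h₂ : s.2 < 2 ^ e) (hN : e + (l.flatMap encodeItem).length ≤ N) :
    accumulate.Exec (store (l.flatMap encodeItem) s.1 s.2 0 0 0 0 m d)
      (l.length * (19 * opTime N) + 2) ()
      (store [] (l.foldl addItem s).1 (l.foldl addItem s).2 0 0 0 0 m d) := by
  induction l generalizing s e with
  | nil =>
    exact Exec.mono (Exec.iter_exit (Exec.bind (exec_pop_nil rfl) exec_pure)) (by simp)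
  | cons i l ih =>
    have hT : 4 ≤ opTime N := by have := linear_le_opTime N; omega
    have hlen : ((i :: l).flatMap encodeItem).length =
        (encodeItem i).length + (l.flatMap encodeItem).length := by
      simp
    have hb := itemBounds h₁ h₂ i
    have hi : (i :: l).flatMap encodeItem =
        some i.1 :: (encodeFrac i.2.1 ++ encodeFrac i.2.2 ++ l.flatMap encodeItem) := by
      simp [encodeItem]
    rw [hi]
    refine Exec.mono (Exec.iter_next (Exec.bind exec_pop_inp
      (Exec.bind (exec_processItem (N := N) ?_ (l.flatMap encodeItem) m d) exec_pure))
      (ih (addItem s i) _ hb.newNum hb.newDen (by omega))) ?_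
    · exact (itemBounds h₁ h₂ i).mono (by omega)
    · rw [List.length_cons]
      nlinarith

theorem length_le_length_flatMap_encodeItem (l : List Item) :
    l.length ≤ (l.flatMap encodeItem).length := by
  induction l with
  | nil => simp
  | cons i l ih => simp [encodeItem] at ih ⊢; omega

theorem foldl_addItem_lt (l : List Item) (s : ℕ × ℕ) (e : ℕ) (h₁ : s.1 < 2 ^ e)
    (h₂ : s.2 < 2 ^ e) :
    (l.foldl addItem s).1 < 2 ^ (e + (l.flatMap encodeItem).length) ∧
      (l.foldl addItem s).2 < 2 ^ (e + (l.flatMap encodeItem).length) := by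
  induction l generalizing s e with
  | nil => simpa using ⟨h₁, h₂⟩
  | cons i l ih =>
    have hb := itemBounds h₁ h₂ i
    have := ih (addItem s i) _ hb.newNum hb.newDen
    simpa [add_assoc] using this

/-- Move stack `a` on top of the input stack, keeping its order. -/
def prepend (a : Reg) : Frag Reg (Option Bool) Unit :=
  (moveTo a .u).bind fun _ => moveTo .u .inp

theorem exec_prepend {a : Reg} (hau : a ≠ .u) (hai : a ≠ .inp) {N x : ℕ}
    {S S' : Reg → List (Option Bool)} (ha : S a = natWord x) (hx : x < 2 ^ N) (hu : S .u = [])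
    (hS : Function.update (Function.update S a (natWord 0)) .inp (natWord x ++ S .inp) = S') :
    (prepend a).Exec S (opTime N) () S' := by
  have hlen := length_natWord_le.2 hx
  refine Exec.congr (Exec.bind (exec_moveTo hau _ S ha)
    (exec_moveTo (by decide) (natWord x).reverse _ (by simp [hu]))) ?_ rfl ?_
  · refine le_trans ?_ (linear_le_opTime N)
    rw [List.length_reverse]
    omega
  · rw [← hS, natWord_zero, List.reverse_reverse]
    funext j; cases a <;> cases j <;> simp_all

/-- The program for the evaluation problem. -/
def evalProgram : Frag Reg (Option Bool) Unit :=
  (push .B (some true)).bind fun _ =>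
  accumulate.bind fun _ =>
  (push .inp none).bind fun _ => (prepend .B).bind fun _ =>
  (push .inp none).bind fun _ => (prepend .A).bind fun _ => push .inp (some false)

theorem store_empty (i : List (Option Bool)) :
    store i 0 0 0 0 0 0 0 0 = Function.update (fun _ => []) .inp i := by
  funext k; cases k <;> simp [store, natWord_zero]

theorem exec_push_inp {s : Option Bool} {i : List (Option Bool)} {a b p q r z m d : ℕ} :
    (push .inp s).Exec (store i a b p q r z m d) 1 () (store (s :: i) a b p q r z m d) :=
  (exec_push Reg.inp s).congr le_rfl rfl (update_inp ..)

theorem exec_push_one {i : List (Option Bool)} {a p q r z m d : ℕ} :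
    (push .B (some true)).Exec (store i a 0 p q r z m d) 1 () (store i a 1 p q r z m d) := by
  refine (exec_push Reg.B (some true)).congr le_rfl rfl ?_
  have : some true :: store i a 0 p q r z m d .B = natWord 1 := by
    simp [store, natWord]
  rw [this, update_B]

/-- The output is built from its last symbol to its first on the emptied input stack; its sign bit
is constant because the numerator is a natural number. At most `L` rounds cost `19 * 32 * (L + 2) ^
2` each, and 700 leaves room for the rest. -/
theorem exec_evalProgram (I : EvalInstance) :
    evalProgram.Exec (Function.update (fun _ => []) .inp (encodeInstance I))
      (700 * ((encodeInstance I).length + 2) ^ 3) ()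
      (Function.update (fun _ => []) .inp (encodeFrac I.regretFrac)) := by
  rw [← store_empty, ← store_empty, encodeInstance_eq]
  obtain ⟨hA, hB⟩ := foldl_addItem_lt I.items (0, 1) 1 (by norm_num) (by norm_num)
  have hlen := length_le_length_flatMap_encodeItem I.items
  have hout : encodeFrac I.regretFrac =
      some false :: (natWord (I.items.foldl addItem (0, 1)).1 ++ none ::
        (natWord (I.items.foldl addItem (0, 1)).2 ++ [none])) := by
    have : ¬ (((I.items.foldl addItem (0, 1)).1 : ℤ) < 0) := by omega
    simp [encodeFrac, EvalInstance.regretFrac, encodeNatSep, natWord, this]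
  rw [hout]
  refine Exec.mono (Exec.bind exec_push_one
    (Exec.bind (exec_accumulate I.items (0, 1) 1 0 0 (by norm_num) (by norm_num) le_rfl)
    (Exec.bind exec_push_inp (Exec.bind (exec_prepend (by decide) (by decide) rfl hB rfl
      (by rw [update_B, update_inp]))
    (Exec.bind exec_push_inp (Exec.bind (exec_prepend (by decide) (by decide) rfl hA rfl
      (by rw [update_A, update_inp]; rfl))
    exec_push_inp)))))) ?_
  generalize (I.items.flatMap encodeItem).length = L at *
  unfold opTime
  nlinarith [Nat.mul_le_mul_right (19 * (32 * (1 + L + 1) ^ 2)) hlen]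

/-- The program for the decision version. -/
def decideProgram : Frag Reg (Option Bool) Bool :=
  (pop .inp).bind fun s =>
  (readNat .inp .M .u).bind fun _ => (readNat .inp .D .u).bind fun _ =>
  (push .B (some true)).bind fun _ =>
  accumulate.bind fun _ =>
  (mulBy .A .D .u .v .w).bind fun _ => (mulBy .M .B .u .v .w).bind fun _ =>
  (subFrom .A .M .u .v).bind fun c =>
  (clear .A).bind fun _ => (clear .B).bind fun _ => (clear .M).bind fun _ =>
  (clear .D).bind fun _ => pure (topBit s || !c)

/-- Cross-multiplication by positive denominators. A negative threshold is always met since the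
regret is nonnegative, so the machine only compares absolute values. -/
theorem regret_threshold_iff (I : EvalInstance) (k : Frac) :
    k.val ≤ I.regret ↔ k.num < 0 ∨
      ¬ (I.items.foldl addItem (0, 1)).1 * k.den <
        k.num.natAbs * (I.items.foldl addItem (0, 1)).2 := by
  obtain ⟨kn, kd, hk⟩ := k
  rw [← I.regretFrac_val]
  have hpos := foldl_addItem_pos I.items (0, 1) one_pos
  unfold Frac.val EvalInstance.regretFrac
  simp only
  generalize (I.items.foldl addItem (0, 1)).1 = A
  generalize (I.items.foldl addItem (0, 1)).2 = B at *
  rw [div_le_div_iff₀ (by exact_mod_cast hk) (by exact_mod_cast hpos), not_lt]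
  norm_cast
  rcases lt_or_ge kn 0 with h | h
  · simp only [h, true_or, iff_true]
    have : kn * B ≤ 0 := mul_nonpos_of_nonpos_of_nonneg h.le (by positivity)
    exact this.trans (by positivity)
  · lift kn to ℕ using h
    simp only [Int.natAbs_natCast]
    have : ¬ ((kn : ℤ) < 0) := by omega
    simp only [this, false_or]
    norm_cast

theorem exec_decideProgram (c : EvalInstance × Frac) {b : Bool}
    (hb : b = true ↔ c.2.val ≤ c.1.regret) :
    decideProgram.Exec (Function.update (fun _ => []) .inp (encodeInstanceThreshold c))
      (700 * ((encodeInstanceThreshold c).length + 2) ^ 3) b (fun _ => []) := by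
  obtain ⟨I, kn, kd, hk⟩ := c
  rw [regret_threshold_iff] at hb
  obtain ⟨hA, hB⟩ := foldl_addItem_lt I.items (0, 1) 1 (by norm_num) (by norm_num)
  have hlen := length_le_length_flatMap_encodeItem I.items
  have hin : encodeInstanceThreshold (I, ⟨kn, kd, hk⟩) = some (decide (kn < 0)) ::
      (encodeNatSep kn.natAbs ++ (encodeNatSep kd ++ I.items.flatMap encodeItem)) := by
    simp [encodeInstanceThreshold, encodeFrac, encodeInstance_eq]
  have hout : (fun _ => [] : Reg → List (Option Bool)) = store [] 0 0 0 0 0 0 0 0 := by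
    rw [store_empty, Function.update_eq_self_iff.2 rfl]
  have hL : (encodeInstanceThreshold (I, ⟨kn, kd, hk⟩)).length =
      kn.natAbs.size + kd.size + 3 + (I.items.flatMap encodeItem).length := by
    rw [encodeInstanceThreshold, List.length_append, length_encodeFrac, encodeInstance_eq]
  rw [hL, ← store_empty, hin, hout]
  simp only at hb
  set X := kn.natAbs.size + kd.size + 3 + (I.items.flatMap encodeItem).length with hX
  have mono : ∀ {y e : ℕ}, y < 2 ^ e → e ≤ X → y < 2 ^ X :=
    fun h h' => h.trans_le (Nat.pow_le_pow_right (by norm_num) h')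
  have mul : ∀ {y z e f : ℕ}, y < 2 ^ e → z < 2 ^ f → y * z < 2 ^ (e + f) := by
    intro y z e f h h'
    rw [pow_add]
    exact Nat.mul_lt_mul'' h h'
  have hM := Nat.lt_size_self kn.natAbs
  have hD := Nat.lt_size_self kd
  -- Both cross products combine a part of the threshold with a part of the regret, so their lengths
  -- are bounded by that of the whole input.
  have hAD := mono (mul hA hD) (by omega)
  have hMB := mono (mul hM hB) (by omega)
  have hA := mono hA (by omega)
  have hB := mono hB (by omega)
  have hM := mono hM (by omega)
  have hD := mono hD (by omega)
  have hsub : (I.items.foldl addItem (0, 1)).1 * kd -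
      kn.natAbs * (I.items.foldl addItem (0, 1)).2 < 2 ^ X := (Nat.sub_le _ _).trans_lt hAD
  refine Exec.congr (Exec.bind exec_pop_inp
    (Exec.bind (exec_readNat_reg (by decide) (by decide) rfl hM rfl rfl (update_inp_M ..))
    (Exec.bind (exec_readNat_reg (by decide) (by decide) rfl hD rfl rfl (update_inp_D ..))
    (Exec.bind exec_push_one
    (Exec.bind (exec_accumulate (N := X) I.items (0, 1) 1 _ _ (by norm_num) (by norm_num)
      (by omega))
    (Exec.bind (exec_mul_reg (by decide) (by decide) (by decide) (by decide) (by decide)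
      (by decide) (by decide) rfl hA rfl hD rfl rfl rfl (update_A ..))
    (Exec.bind (exec_mul_reg (by decide) (by decide) (by decide) (by decide) (by decide)
      (by decide) (by decide) rfl hM rfl hB rfl rfl rfl (update_M ..))
    (Exec.bind (exec_sub_reg (by decide) (by decide) (by decide) (by decide) (by decide)
      rfl hAD rfl hMB rfl rfl (update_A ..))
    (Exec.bind (exec_clear_reg rfl hsub (update_A ..))
    (Exec.bind (exec_clear_reg rfl hB (update_B ..))
    (Exec.bind (exec_clear_reg rfl hMB (update_M ..))
    (Exec.bind (exec_clear_reg rfl hD (update_D ..)) exec_pure)))))))))))) ?_ ?_ rfl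
  · have hlX : I.items.length ≤ X := by omega
    unfold opTime
    nlinarith [Nat.mul_le_mul_right (19 * (32 * (X + 1) ^ 2)) hlX]
  · rw [Bool.eq_iff_iff, hb]
    simp [topBit]

theorem evalInstance_polyTimeEvaluable : PolyTimeEvaluable encodeInstance EvalInstance.regret :=
  ⟨EvalInstance.regretFrac, EvalInstance.regretFrac_val,
    computableInPolyTime_of_exec evalProgram .inp .inp
      (Polynomial.C 700 * (Polynomial.X + Polynomial.C 2) ^ 3) fun I =>
        ⟨(), (exec_evalProgram I).mono (by simp)⟩⟩

open Classical in
theorem regretThreshold_inP :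
    InP encodeInstanceThreshold {p : EvalInstance × Frac | p.2.val ≤ p.1.regret} :=
  decidableInPolyTime_of_exec decideProgram .inp
    (Polynomial.C 700 * (Polynomial.X + Polynomial.C 2) ^ 3) fun c =>
      (exec_decideProgram c (by simp)).mono (by simp)

end MinmaxRegret

open MinmaxRegret in
theorem mainTheorem9 :
    -- the regret is an attained maximum, with the stated closed form
    (∀ (n : ℕ) (chat d x : Fin n → ℝ), (∀ i, 0 ≤ d i) → x ∈ binaryCube n →
      (∀ c : Fin n → ℝ, IsLeast ((fun y => c ⬝ᵥ y) '' binaryCube n) (opt (binaryCube n) c)) ∧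
      IsGreatest (regretValues (binaryCube n) (hyperbox chat d) x)
        (regret (binaryCube n) (hyperbox chat d) x) ∧
      regret (binaryCube n) (hyperbox chat d) x =
        ∑ i, worstScenario chat d x i * x i - ∑ i, min 0 (worstScenario chat d x i)) ∧
    -- one program evaluates the regret with `O(n)` arithmetic operations
    (∃ (P : List RamInstr) (C : ℕ), ∀ (n : ℕ) (chat d x : Fin n → ℝ),
      (∀ i, 0 ≤ d i) → x ∈ binaryCube n →
        RamOutputsWithin P (ramInit chat d x) (C * (n + 1))
          (regret (binaryCube n) (hyperbox chat d) x)) ∧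
    -- for rational data, a Turing machine computes the regret in polynomial time
    PolyTimeEvaluable encodeInstance EvalInstance.regret ∧
    -- and comparing the regret with a given rational threshold is in P
    InP encodeInstanceThreshold {p : EvalInstance × Frac | p.2.val ≤ p.1.regret} := by
  refine ⟨fun n chat d x hd hx => regret_closed_form hd hx,
    ⟨regretProgram, 16, fun n chat d x hd hx => ?_⟩, evalInstance_polyTimeEvaluable,
    regretThreshold_inP⟩
  rw [regret_eq_sum hd hx]
  exact ramOutputsWithin_regretProgram chat d x
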